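/- Let $G$ be a finite simple graph. In the hat guessing game $(G,h,g)$, with integers $h,g\ge 1$, a hat of one of $h$ colors is put on each vertex of $G$; each vertex sees exactly the colors on its neighbors and, by a deterministic strategy fixed in advance, guesses a set of exactly $g$ colors. The game is winning if there is a strategy such that, for every assignment of colors, at least one vertex has its own color among its guesses. The fractional hat chromatic number of $G$ is $$\hat\mu(G)=\sup\Bigl\{\tfrac hg : (G,h,g)\text{ is winning}\Bigr\}.$$ A graph is chordal if every cycle of length at least $4$ has a chord. There is an algorithm $\mathcal A$ which, given a chordal graph $G$ on $n\ge 1$ vertices (as its adjacency matrix) and an integer $k\ge 1$, outputs a rational number $t$ with $|t-\hat\mu(G)|\le 2^{-k}$. Its running time is $2k\cdot\mathrm{poly}(n)$: it is a program of a random access machine with exact rational arithmetic, and there are polynomials $p,q$ such that on every such input it halts after at most $2k\cdot p(n)$ elementary steps (arithmetic operations $+,-,\cdot,/$, comparisons, and memory accesses), while every number that it computes has a numerator and denominator (in lowest terms) with at most $k\cdot q(n)$ binary digits in total. Moreover, if $\hat\mu(G)$ is rational, then $\hat\mu(G)$ is an integer, and $\mathcal A$ outputs its exact value $t=\hat\mu(G)$.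 -/

import Mathlib

namespace HatGuessing

/-! ### The game and the fractional hat chromatic number -/

/-- Every cycle of length at least 4 has a chord: an edge of the graph that joins two vertices of
the cycle and is not an edge of the cycle. -/
def IsChordal {V : Type*} (G : SimpleGraph V) : Prop :=
  ∀ (v : V) (c : G.Walk v v), c.IsCycle → 4 ≤ c.length →
    ∃ x ∈ c.support, ∃ y ∈ c.support, G.Adj x y ∧ s(x, y) ∉ c.edges

/-- A strategy for the game `(G, h, g)`: the bear on `v` sees the colors of the hats on the
neighbors of `v` and guesses a set of exactly `g` of the `h` colors. -/
def Strategy {V : Type*} (G : SimpleGraph V) (h g : ℕ) : Type _ :=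
  (v : V) → (G.neighborSet v → Fin h) → {A : Finset (Fin h) // A.card = g}

/-- For every hats arrangement at least one bear guesses correctly. -/
def Strategy.IsWinning {V : Type*} {G : SimpleGraph V} {h g : ℕ} (Γ : Strategy G h g) : Prop :=
  ∀ φ : V → Fin h, ∃ v : V, φ v ∈ (Γ v (fun u => φ u)).val

/-- The hat guessing game `(G, h, g)` is winning. -/
def IsWinningGame {V : Type*} (G : SimpleGraph V) (h g : ℕ) : Prop :=
  ∃ Γ : Strategy G h g, Γ.IsWinning

/-- The fractional hat chromatic number: the supremum of `h / g` over all winning games. -/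
noncomputable def fracHatNumber {V : Type*} (G : SimpleGraph V) : ℝ :=
  sSup {x : ℝ | ∃ h g : ℕ, 0 < h ∧ 0 < g ∧ IsWinningGame G h g ∧ x = (h : ℝ) / g}

/-! ### Algorithms

Programs of a random access machine with exact rational arithmetic. A program is a fixed finite
text. It uses registers and arrays, both named by natural numbers, whose entries are rationals.
One arithmetic operation, comparison, assignment, array read or array write is one step. The
semantics also keeps track of the size of the numbers that are computed. -/

/-- The arithmetic operations. -/
inductive Op
  | add
  | sub
  | mul
  | div

/-- The value of an arithmetic operation; a division by zero returns zero. -/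
def Op.eval : Op → ℚ → ℚ → ℚ
  | .add, a, b => a + b
  | .sub, a, b => a - b
  | .mul, a, b => a * b
  | .div, a, b => a / b

/-- Programs. -/
inductive Prog
  /-- do nothing -/
  | skip
  /-- `x := q` -/
  | const (x : ℕ) (q : ℚ)
  /-- `x := y o z` -/
  | arith (o : Op) (x y z : ℕ)
  /-- `x := a[i]`, where `a` is the name of an array and `i` is a register -/
  | load (x a i : ℕ)
  /-- `a[i] := x`, where `a` is the name of an array and `i` is a register -/
  | store (a i x : ℕ)
  /-- first `P`, then `Q` -/
  | seq (P Q : Prog)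
  /-- if `x < y` then `P` else `Q` -/
  | ite (x y : ℕ) (P Q : Prog)
  /-- while `x < y` do `P` -/
  | loop (x y : ℕ) (P : Prog)

/-- The state of the memory. -/
structure State where
  /-- contents of the registers -/
  reg : ℕ → ℚ
  /-- `arr a i` is entry `i` of the array `a` -/
  arr : ℕ → ℕ → ℚ

/-- Write `q` into register `x`. -/
def State.setReg (s : State) (x : ℕ) (q : ℚ) : State :=
  { s with reg := Function.update s.reg x q }

/-- Write `q` into entry `i` of the array `a`. -/
def State.setArr (s : State) (a i : ℕ) (q : ℚ) : State :=
  { s with arr := Function.update s.arr a (Function.update (s.arr a) i q) }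

/-- The number of binary digits of numerator and denominator of a rational in lowest terms. -/
def bitLength (q : ℚ) : ℕ :=
  q.num.natAbs.size + q.den.size

/-- `Run b P s t s'`: started in the state `s`, the program `P` halts in the state `s'` after
exactly `t` steps, and every number that it writes on the way has bit length at most `b`. An array
index `r` that is not a natural number is rounded down (to `0` if `r` is negative). -/
inductive Run (b : ℕ) : Prog → State → ℕ → State → Prop
  | skip (s : State) : Run b .skip s 1 s
  | const (x : ℕ) (q : ℚ) (s : State) (hb : bitLength q ≤ b) :
      Run b (.const x q) s 1 (s.setReg x q)
  | arith (o : Op) (x y z : ℕ) (s : State) (hb : bitLength (o.eval (s.reg y) (s.reg z)) ≤ b) :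
      Run b (.arith o x y z) s 1 (s.setReg x (o.eval (s.reg y) (s.reg z)))
  | load (x a i : ℕ) (s : State) (hb : bitLength (s.arr a ⌊s.reg i⌋₊) ≤ b) :
      Run b (.load x a i) s 1 (s.setReg x (s.arr a ⌊s.reg i⌋₊))
  | store (a i x : ℕ) (s : State) (hb : bitLength (s.reg x) ≤ b) :
      Run b (.store a i x) s 1 (s.setArr a ⌊s.reg i⌋₊ (s.reg x))
  | seq {P Q : Prog} {s s' s'' : State} {t t' : ℕ} (hP : Run b P s t s') (hQ : Run b Q s' t' s'') :
      Run b (.seq P Q) s (t + t') s''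
  | ite_true {x y : ℕ} {P Q : Prog} {s s' : State} {t : ℕ} (h : s.reg x < s.reg y)
      (hP : Run b P s t s') : Run b (.ite x y P Q) s (t + 1) s'
  | ite_false {x y : ℕ} {P Q : Prog} {s s' : State} {t : ℕ} (h : ¬ s.reg x < s.reg y)
      (hQ : Run b Q s t s') : Run b (.ite x y P Q) s (t + 1) s'
  | loop_false {x y : ℕ} {P : Prog} {s : State} (h : ¬ s.reg x < s.reg y) :
      Run b (.loop x y P) s 1 s
  | loop_true {x y : ℕ} {P : Prog} {s s' s'' : State} {t t' : ℕ} (h : s.reg x < s.reg y)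
      (hP : Run b P s t s') (hL : Run b (.loop x y P) s' t' s'') :
      Run b (.loop x y P) s (t + t' + 1) s''

open Classical in
/-- The initial memory for the input `(G, k)`: register 0 holds the number `n` of vertices,
register 1 holds `k`, array 0 holds the adjacency matrix of `G` row by row, and everything else is
zero. -/
noncomputable def input {n : ℕ} (G : SimpleGraph (Fin n)) (k : ℕ) : State where
  reg x := if x = 0 then (n : ℚ) else if x = 1 then (k : ℚ) else 0
  arr a i := if a = 0 ∧ ∃ u v : Fin n, G.Adj u v ∧ i = n * (u : ℕ) + (v : ℕ) then 1 else 0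

/-- The output of a computation that halts in the state `s` is the content of register 0. -/
def State.output (s : State) : ℚ :=
  s.reg 0

end HatGuessing

/-!
Eliminating a simplicial vertex `v` of weight `x v` divides the weights of its neighbors by
`1 - x v`. Weights are called feasible if, along an elimination order of a chordal graph, they stay
in `[0, 1)`; then the signed independence polynomial, which is multiplied by `1 - x v` in each
step, is positive, and the argument of the lopsided local lemma defeats every strategy. If the
weights are not feasible, a winning strategy is built along the order. Hence `y ≤ μ̂(G)` if and
only if the constant weight `1 / y` is not feasible, which a program can test, and binary search
finds `μ̂(G)`. The weights that occur are ratios of values of the independence polynomial, so they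
have short numerators and denominators. If `μ̂(G)` is rational then its inverse is a root of the
independence polynomial of a subgraph, and since this polynomial has constant term `1`, the
rational root theorem makes `μ̂(G)` an integer.
-/

namespace HatGuessing

/-! ### Chordal graphs -/

section Chordal

variable {V : Type*} {G : SimpleGraph V}

theorem isChordless_of_length_eq_dist {s t : V} (p : G.Walk s t) (hp : p.length = G.dist s t) :
    p.IsChordless := by
  classical
  have mem_edges_of_isSubwalk {a b : V} (q : G.Walk a b) (hq : q.IsSubwalk p)
      (hab : G.Adj a b) : s(a, b) ∈ p.edges := by
    have hlen : q.length = 1 :=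
      (SimpleGraph.length_eq_dist_of_subwalk hp hq).trans (SimpleGraph.dist_eq_one_iff_adj.2 hab)
    cases q with
    | nil => simp at hlen
    | cons h q =>
      cases q with
      | nil => exact hq.edges_subset (by simp)
      | cons h' q => simp at hlen
  rw [SimpleGraph.Walk.isChordless_iff_forall_mem_edges]
  intro x y hx hy hxy
  rw [← p.take_spec hx, SimpleGraph.Walk.mem_support_append_iff] at hy
  rcases hy with hy | hy
  · rw [Sym2.eq_swap]
    exact mem_edges_of_isSubwalk ((p.takeUntil x hx).dropUntil y hy)
      (((p.takeUntil x hx).isSubwalk_dropUntil hy).trans (p.isSubwalk_takeUntil hx)) hxy.symm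
  · exact mem_edges_of_isSubwalk ((p.dropUntil x hx).takeUntil y hy)
      (((p.dropUntil x hx).isSubwalk_takeUntil hy).trans (p.isSubwalk_dropUntil hx)) hxy

theorem mem_support_map {V' : Type*} {G' : SimpleGraph V'} (f : G' ↪g G) {s t : V'}
    {p : G'.Walk s t} {x : V} : x ∈ (p.map f.toHom).support ↔ ∃ y ∈ p.support, f y = x := by
  rw [SimpleGraph.Walk.support_map, List.mem_map]
  rfl

theorem isChordless_map {V' : Type*} {G' : SimpleGraph V'} (f : G' ↪g G) {s t : V'}
    {p : G'.Walk s t} (hp : p.IsChordless) : (p.map f.toHom).IsChordless := by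
  rw [SimpleGraph.Walk.isChordless_iff_forall_mem_edges]
  intro x y hx hy hxy
  obtain ⟨x, hxp, rfl⟩ := (mem_support_map f).1 hx
  obtain ⟨y, hyp, rfl⟩ := (mem_support_map f).1 hy
  rw [SimpleGraph.Walk.edges_map, List.mem_map]
  exact ⟨s(x, y), hp.mem_edges hxp hyp (f.map_adj_iff.1 hxy), rfl⟩

theorem exists_isPath_isChordless {W : Set V} {s t : W} (h : (G.induce W).Reachable s t) :
    ∃ p : G.Walk s t, p.IsPath ∧ p.IsChordless ∧ ∀ x ∈ p.support, x ∈ W := by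
  obtain ⟨p, hp, hdist⟩ := h.exists_path_of_dist
  let f : G.induce W ↪g G := SimpleGraph.Embedding.induce W
  refine ⟨p.map f.toHom, hp.map f.injective,
    isChordless_map f (isChordless_of_length_eq_dist p hdist), fun x hx => ?_⟩
  obtain ⟨y, -, rfl⟩ := (mem_support_map f).1 hx
  exact y.2

theorem isCycle_cons_concat {v s t : V} {p : G.Walk s t} (hp : p.IsPath) (hv : v ∉ p.support)
    (hst : s ≠ t) (hs : G.Adj v s) (ht : G.Adj t v) :
    (SimpleGraph.Walk.cons hs (p.concat ht)).IsCycle := by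
  refine (SimpleGraph.Walk.cons_isCycle_iff _ _).2 ⟨hp.concat hv ht, fun h => ?_⟩
  rw [SimpleGraph.Walk.edges_concat, List.concat_eq_append, List.mem_append] at h
  rcases h with h | h
  · exact hv (p.fst_mem_support_of_mem_edges h)
  · have hne := ht.ne
    simp_all

theorem IsChordal.adj_of_isChordless (hG : IsChordal G) {v s t : V} {p : G.Walk s t}
    (hp : p.IsPath) (hchord : p.IsChordless) (hv : v ∉ p.support)
    (hadj : ∀ x ∈ p.support, G.Adj v x → x = s ∨ x = t)
    (hst : s ≠ t) (hs : G.Adj v s) (ht : G.Adj v t) : G.Adj s t := by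
  by_contra hna
  have hlen : 2 ≤ p.length :=
    (p.reachable.one_lt_dist_of_ne_of_not_adj hst hna).trans_le (SimpleGraph.dist_le p)
  obtain ⟨x, hx, y, hy, hxy, he⟩ := hG v _ (isCycle_cons_concat hp hv hst hs ht.symm)
    (by simp only [SimpleGraph.Walk.length_cons, SimpleGraph.Walk.length_concat]; omega)
  simp only [SimpleGraph.Walk.support_cons, SimpleGraph.Walk.support_concat, List.mem_cons,
    List.mem_append, List.not_mem_nil, or_false, SimpleGraph.Walk.edges_cons,
    SimpleGraph.Walk.edges_concat, List.concat_eq_append, not_or] at hx hy he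
  grind [hchord.mem_edges, hxy.ne, hxy.symm, Sym2.eq_swap]

theorem IsChordal.adj_of_connected (hG : IsChordal G) {v s t c d : V} {C : Set V}
    (hC : (G.induce C).Connected) (hv : ∀ c ∈ C, c ≠ v ∧ ¬ G.Adj v c) (hst : s ≠ t)
    (hs : G.Adj v s) (ht : G.Adj v t) (hc : c ∈ C) (hsc : G.Adj s c) (hd : d ∈ C)
    (htd : G.Adj t d) : G.Adj s t := by
  have hsC : (G.induce ({s} ∪ C)).Connected :=
    G.connected_induce_union .of_subsingleton
      hC.preconnected rfl hc hsc
  have hsCt : (G.induce (({s} ∪ C) ∪ {t})).Connected :=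
    G.connected_induce_union hsC.preconnected
      .of_subsingleton (.inr hd) rfl htd.symm
  obtain ⟨p, hp, hchord, hsupp⟩ := exists_isPath_isChordless
    (hsCt ⟨s, .inl (.inl rfl)⟩ ⟨t, .inr rfl⟩)
  refine hG.adj_of_isChordless hp hchord (fun h => ?_) (fun x hx hvx => ?_) hst hs ht
  · rcases hsupp v h with (h | h) | h
    · exact hs.ne h
    · exact (hv v h).1 rfl
    · exact ht.ne h
  · rcases hsupp x hx with (h | h) | h
    · exact .inl h
    · exact absurd hvx (hv x h).2
    · exact .inr h

theorem exists_connected_component_of_mem {W : Set V} {x : V} (hx : x ∈ W) :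
    ∃ C ⊆ W, x ∈ C ∧ (G.induce C).Connected ∧ ∀ c ∈ C, ∀ a ∈ W, G.Adj c a → a ∈ C := by
  let connectedSets : Set (Set V) := {S | S ⊆ W ∧ x ∈ S ∧ (G.induce S).Connected}
  have hx_mem : {x} ∈ connectedSets := ⟨by simpa, rfl, .mk .of_subsingleton⟩
  have hconn : (G.induce (⋃₀ connectedSets)).Connected :=
    G.induce_sUnion_connected_of_pairwise_not_disjoint ⟨_, hx_mem⟩
      (fun hS hT => ⟨x, hS.2.1, hT.2.1⟩) fun hS => hS.2.2
  have hsub : ⋃₀ connectedSets ⊆ W := Set.sUnion_subset fun S hS => hS.1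
  have hx_sUnion : x ∈ ⋃₀ connectedSets := ⟨_, hx_mem, rfl⟩
  refine ⟨⋃₀ connectedSets, hsub, hx_sUnion, hconn, fun c hc a ha hca => ?_⟩
  have hunion : ⋃₀ connectedSets ∪ {a} ∈ connectedSets :=
    ⟨Set.union_subset hsub (by simpa), .inl hx_sUnion,
      G.connected_induce_union hconn.preconnected .of_subsingleton hc rfl hca⟩
  exact Set.mem_sUnion_of_mem (Set.mem_union_right _ (Set.mem_singleton a)) hunion

/-- `z` is simplicial in the subgraph induced by `U`. The vertex `z` itself need not lie in `U`, so
that the notion also applies to a vertex and the set of its successors in an elimination order. -/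
def IsSimplicialIn (G : SimpleGraph V) (U : Set V) (z : V) : Prop :=
  G.IsClique (U ∩ G.neighborSet z)

theorem IsSimplicialIn.mono {U U' : Set V} {z : V} (hz : IsSimplicialIn G U' z)
    (h : U ∩ G.neighborSet z ⊆ U') : IsSimplicialIn G U z :=
  SimpleGraph.IsClique.subset (Set.subset_inter h Set.inter_subset_right) hz

theorem IsChordal.exists_isClique_separator (hG : IsChordal G) {U : Finset V} {v x : V}
    (hx : x ∈ U) (hxv : x ≠ v) (hvx : ¬ G.Adj v x) :
    ∃ C S : Set V, x ∈ C ∧ (∀ c ∈ C, c ∈ U ∧ c ≠ v ∧ ¬ G.Adj v c) ∧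
      S ⊆ U ∩ G.neighborSet v ∧ G.IsClique S ∧ ∀ c ∈ C, ∀ a ∈ U, G.Adj c a → a ∈ C ∪ S := by
  obtain ⟨C, hCW, hxC, hconn, hclosed⟩ := exists_connected_component_of_mem (G := G)
    (W := {y | y ∈ U ∧ y ≠ v ∧ ¬ G.Adj v y}) ⟨hx, hxv, hvx⟩
  refine ⟨C, {s | s ∈ U ∧ G.Adj v s ∧ ∃ c ∈ C, G.Adj s c}, hxC, fun c hc => hCW hc,
    fun s hs => ⟨hs.1, hs.2.1⟩, ?_, fun c hc a ha hca => ?_⟩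
  · rintro s ⟨-, hvs, c, hc, hsc⟩ t ⟨-, hvt, d, hd, htd⟩ hst
    exact hG.adj_of_connected hconn (fun c hc => (hCW hc).2) hst hvs hvt hc hsc hd htd
  · by_cases hva : G.Adj v a
    · exact .inr ⟨ha, hva, c, hc, hca.symm⟩
    · refine .inl (hclosed c hc a ⟨ha, ?_, hva⟩ hca)
      rintro rfl
      exact (hCW hc).2.2 hca.symm

theorem IsChordal.exists_isSimplicialIn_not_adj (hG : IsChordal G) (U : Finset V) :
    ∀ v ∈ U, ∀ x ∈ U, x ≠ v → ¬ G.Adj v x →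
      ∃ z ∈ U, z ≠ v ∧ ¬ G.Adj v z ∧ IsSimplicialIn G U z := by
  classical
  induction U using Finset.strongInduction with
  | H U ih =>
  intro v hv x hx hxv hvx
  obtain ⟨C, S, hxC, hC, hS, hclique, hnbr⟩ := hG.exists_isClique_separator hx hxv hvx
  set U' : Finset V := U.filter (· ∈ C ∪ S)
  have hU'_ssub : U' ⊂ U := by
    refine Finset.filter_ssubset.2 ⟨v, hv, ?_⟩
    rintro (h | h)
    · exact (hC v h).2.1 rfl
    · exact G.loopless.irrefl v (hS h).2
  have hmem (y : V) (hy : y ∈ U') : y ∈ C ∨ y ∈ S := (Finset.mem_filter.1 hy).2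
  suffices h : ∃ z ∈ C, IsSimplicialIn G U' z by
    obtain ⟨z, hz, hzU'⟩ := h
    obtain ⟨hzU, hzv, hvz⟩ := hC z hz
    exact ⟨z, hzU, hzv, hvz, hzU'.mono fun a ha =>
      Finset.mem_filter.2 ⟨ha.1, hnbr z hz a ha.1 ha.2⟩⟩
  by_cases hcl : G.IsClique (U' : Set V)
  · exact ⟨x, hxC, hcl.subset Set.inter_subset_left⟩
  · obtain ⟨a, ha, b, hb, hab, hnab⟩ : ∃ a ∈ U', ∃ b ∈ U', a ≠ b ∧ ¬ G.Adj a b := by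
      simpa [SimpleGraph.IsClique, Set.Pairwise] using hcl
    -- The clique `S` contains at most one of two nonadjacent simplicial vertices of `C ∪ S`.
    obtain ⟨y, hy, hya, hay, hyU'⟩ := ih U' hU'_ssub a ha b hb hab.symm hnab
    obtain ⟨z, hz, hzy, hyz, hzU'⟩ := ih U' hU'_ssub y hy a ha hya.symm (hay ∘ .symm)
    rcases hmem y hy with hyC | hyS
    · exact ⟨y, hyC, hyU'⟩
    · exact ⟨z, (hmem z hz).resolve_right fun hzS => hyz (hclique hyS hzS hzy.symm), hzU'⟩

theorem IsChordal.exists_isSimplicialIn (hG : IsChordal G) {U : Finset V} (hU : U.Nonempty) :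
    ∃ z ∈ U, IsSimplicialIn G U z := by
  by_cases hcl : G.IsClique (U : Set V)
  · obtain ⟨z, hz⟩ := hU
    exact ⟨z, hz, hcl.subset Set.inter_subset_left⟩
  · obtain ⟨v, hv, x, hx, hvx, hnvx⟩ : ∃ v ∈ U, ∃ x ∈ U, v ≠ x ∧ ¬ G.Adj v x := by
      simpa [SimpleGraph.IsClique, Set.Pairwise] using hcl
    obtain ⟨z, hz, -, -, hzU⟩ := hG.exists_isSimplicialIn_not_adj U v hv x hx hvx.symm hnvx
    exact ⟨z, hz, hzU⟩

/-- A perfect elimination order: every vertex is simplicial among its successors. -/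
def IsElimOrder (G : SimpleGraph V) : List V → Prop
  | [] => True
  | v :: l => v ∉ l ∧ IsSimplicialIn G {x | x ∈ l} v ∧ IsElimOrder G l

theorem IsElimOrder.sublist {l l' : List V} (h : l'.Sublist l) (hl : IsElimOrder G l) :
    IsElimOrder G l' := by
  induction h with
  | slnil => trivial
  | cons a _ ih => exact ih hl.2.2
  | cons_cons a h ih =>
    exact ⟨fun ha => hl.1 (h.subset ha), hl.2.1.mono fun x hx => h.subset hx.1, ih hl.2.2⟩

theorem IsElimOrder.nodup {l : List V} (h : IsElimOrder G l) : l.Nodup := by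
  induction l with
  | nil => simp
  | cons v l ih => exact List.nodup_cons.2 ⟨h.1, ih h.2.2⟩

theorem IsChordal.exists_isElimOrder (hG : IsChordal G) (U : Finset V) :
    ∃ l, IsElimOrder G l ∧ ∀ v, v ∈ l ↔ v ∈ U := by
  classical
  induction U using Finset.strongInduction with
  | H U ih =>
  rcases U.eq_empty_or_nonempty with rfl | hU
  · exact ⟨[], trivial, by simp⟩
  · obtain ⟨z, hz, hzU⟩ := hG.exists_isSimplicialIn hU
    obtain ⟨l, hl, hmem⟩ := ih (U.erase z) (Finset.erase_ssubset hz)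
    refine ⟨z :: l, ⟨by simp [hmem], hzU.mono fun x hx => ?_, hl⟩, fun v => ?_⟩
    · exact Finset.mem_of_mem_erase ((hmem x).1 hx.1)
    · rw [List.mem_cons, hmem, Finset.mem_erase]
      by_cases hv : v = z <;> simp [hv, hz]

end Chordal

/-! ### The signed independence polynomial and the elimination of vertices -/

section IndepValue

variable {V R R' : Type*} {G : SimpleGraph V} [CommRing R] [CommRing R']

open Classical in
/-- The independent sets of `G` that are contained in `S`. -/
noncomputable def indepSubsets (G : SimpleGraph V) (S : Finset V) : Finset (Finset V) :=
  S.powerset.filter fun I => G.IsIndepSet (I : Set V)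

theorem mem_indepSubsets {S I : Finset V} :
    I ∈ indepSubsets G S ↔ I ⊆ S ∧ G.IsIndepSet (I : Set V) := by
  simp [indepSubsets]

/-- The signed independence polynomial of the subgraph of `G` induced by `S`, evaluated at the
weights `w`: the sum of `∏ v ∈ I, -w v` over the independent sets `I ⊆ S`. -/
noncomputable def indepValue (G : SimpleGraph V) (w : V → R) (S : Finset V) : R :=
  ∑ I ∈ indepSubsets G S, ∏ v ∈ I, -w v

@[simp]
theorem indepValue_empty (w : V → R) : indepValue G w ∅ = 1 := by
  simp [indepValue, indepSubsets, Finset.sum_filter]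

theorem map_indepValue (f : R →+* R') (w : V → R) (S : Finset V) :
    f (indepValue G w S) = indepValue G (fun v => f (w v)) S := by
  simp only [indepValue, map_sum, map_prod, map_neg]

theorem indepValue_zero (S : Finset V) : indepValue G (fun _ => (0 : R)) S = 1 := by
  rw [indepValue, Finset.sum_eq_single ∅]
  · simp
  · intro I _ hI
    simp [Finset.card_ne_zero.2 (Finset.nonempty_iff_ne_empty.2 hI)]
  · simp [mem_indepSubsets]

open Classical in
theorem indepValue_filter_not_adj (w : V → R) (v : V) (S : Finset V) :
    indepValue G w (S.filter fun u => ¬ G.Adj v u) =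
      ∑ I ∈ indepSubsets G S,
        if ∀ u ∈ I, ¬ G.Adj v u then ∏ u ∈ I, -w u else 0 := by
  rw [indepValue, ← Finset.sum_filter]
  refine Finset.sum_congr ?_ fun _ _ => rfl
  ext I
  simp only [Finset.mem_filter, mem_indepSubsets, Finset.subset_iff]
  grind

open Classical in
theorem indepValue_insert [DecidableEq V] (w : V → R) {v : V} {S : Finset V} (hv : v ∉ S) :
    indepValue G w (insert v S) =
      indepValue G w S - w v * indepValue G w (S.filter fun u => ¬ G.Adj v u) := by
  rw [indepValue_filter_not_adj, sub_eq_add_neg, ← neg_mul, Finset.mul_sum]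
  simp only [indepValue, indepSubsets, Finset.sum_filter, Finset.sum_powerset_insert hv]
  congr 1
  refine Finset.sum_congr rfl fun I hI => ?_
  have hvI : v ∉ I := fun h => hv (Finset.mem_powerset.1 hI h)
  have hindep : G.IsIndepSet (insert v I : Finset V) ↔
      G.IsIndepSet (I : Set V) ∧ ∀ u ∈ I, ¬ G.Adj v u := by
    have : Std.Symm fun a b => ¬ G.Adj a b := ⟨fun _ _ h => h ∘ .symm⟩
    rw [Finset.coe_insert, SimpleGraph.IsIndepSet,
      Set.pairwise_insert_of_symm_of_notMem (Finset.mem_coe.not.2 hvI)]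
    rfl
  simp only [hindep, ite_and, Finset.prod_insert hvI, mul_ite, mul_zero]

end IndepValue

section Elimination

variable {V K : Type*} {G : SimpleGraph V} [Field K]

open Classical in
/-- The weights that are left after the elimination of `v`: those of the neighbors of `v` are
divided by `1 - w v`. -/
noncomputable def reweight (G : SimpleGraph V) (v : V) (w : V → K) (u : V) : K :=
  if G.Adj v u then w u / (1 - w v) else w u

/-- The weights after the elimination of all vertices of a list. -/
noncomputable def weightAfter (G : SimpleGraph V) : List V → (V → K) → V → K
  | [], w => w
  | v :: l, w => weightAfter G l (reweight G v w)

theorem weightAfter_append (l₁ l₂ : List V) (w : V → K) :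
    weightAfter G (l₁ ++ l₂) w = weightAfter G l₂ (weightAfter G l₁ w) := by
  induction l₁ generalizing w with
  | nil => rfl
  | cons v _ ih => exact ih (reweight G v w)

open Classical in
theorem prod_neg_reweight {w : V → K} {v : V} {I : Finset V} (hv : w v ≠ 1)
    (hI : G.IsIndepSet (I : Set V)) (hs : IsSimplicialIn G I v) :
    (1 - w v) * ∏ u ∈ I, -reweight G v w u =
      (∏ u ∈ I, -w u) - w v * if ∀ u ∈ I, ¬ G.Adj v u then ∏ u ∈ I, -w u else 0 := by
  split_ifs with h
  · rw [Finset.prod_congr rfl fun u hu => by rw [reweight, if_neg (h u hu)]]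
    ring
  · obtain ⟨u, hu, hvu⟩ : ∃ u ∈ I, G.Adj v u := by simpa using h
    have hrest : ∀ x ∈ I.erase u, -reweight G v w x = -w x := fun x hx => by
      obtain ⟨hxu, hx⟩ := Finset.mem_erase.1 hx
      have hvx : ¬ G.Adj v x := fun hvx => hI hx hu hxu (hs ⟨hx, hvx⟩ ⟨hu, hvu⟩ hxu)
      rw [reweight, if_neg hvx]
    rw [← Finset.mul_prod_erase I _ hu, Finset.prod_congr rfl hrest,
      ← Finset.mul_prod_erase I _ hu, reweight, if_pos hvu]
    field_simp [sub_ne_zero.2 hv.symm]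
    ring

open Classical in
theorem indepValue_reweight {w : V → K} {v : V} {S : Finset V} (hv : w v ≠ 1)
    (hs : IsSimplicialIn G S v) :
    (1 - w v) * indepValue G (reweight G v w) S =
      indepValue G w S - w v * indepValue G w (S.filter fun u => ¬ G.Adj v u) := by
  rw [indepValue_filter_not_adj, indepValue, indepValue, Finset.mul_sum, Finset.mul_sum,
    ← Finset.sum_sub_distrib]
  refine Finset.sum_congr rfl fun I hI => ?_
  obtain ⟨hIS, hI⟩ := mem_indepSubsets.1 hI
  exact prod_neg_reweight hv hI (hs.mono fun u hu => hIS hu.1)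

theorem IsElimOrder.indepValue_cons [DecidableEq V] {w : V → K} {v : V} {l : List V}
    (h : IsElimOrder G (v :: l)) (hv : w v ≠ 1) :
    indepValue G w (v :: l).toFinset = (1 - w v) * indepValue G (reweight G v w) l.toFinset := by
  classical
  rw [indepValue_reweight hv (h.2.1.mono fun x hx => by simpa using hx.1), List.toFinset_cons]
  convert indepValue_insert w (mt List.mem_toFinset.1 h.1)

variable [LinearOrder K]

/-- Every vertex of the list has weight less than `1` when it is eliminated. -/
def Feasible (G : SimpleGraph V) : List V → (V → K) → Prop
  | [], _ => True
  | v :: l, w => w v < 1 ∧ Feasible G l (reweight G v w)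

theorem feasible_append (l₁ l₂ : List V) (w : V → K) :
    Feasible G (l₁ ++ l₂) w ↔ Feasible G l₁ w ∧ Feasible G l₂ (weightAfter G l₁ w) := by
  induction l₁ generalizing w with
  | nil => simp [Feasible, weightAfter]
  | cons v l ih => simp [Feasible, weightAfter, ih, and_assoc]

theorem IsElimOrder.indepValue_concat [DecidableEq V] {w : V → K} {l : List V} {u : V}
    (h : IsElimOrder G (l ++ [u])) (hf : Feasible G l w) :
    indepValue G w (l ++ [u]).toFinset =
      indepValue G w l.toFinset * (1 - weightAfter G l w u) := by
  induction l generalizing w with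
  | nil =>
    rw [List.nil_append, List.toFinset_cons, List.toFinset_nil,
      indepValue_insert _ (Finset.notMem_empty _)]
    simp [weightAfter]
  | cons v l ih =>
    rw [List.cons_append] at h ⊢
    rw [h.indepValue_cons hf.1.ne, ih h.2.2 hf.2,
      (h.sublist (by simp : (v :: l).Sublist (v :: (l ++ [u])))).indepValue_cons hf.1.ne,
      mul_assoc, weightAfter]

variable [IsStrictOrderedRing K]

theorem reweight_nonneg {v : V} {w : V → K} (hw : ∀ u, 0 ≤ w u) (hv : w v < 1) (u : V) :
    0 ≤ reweight G v w u := by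
  unfold reweight
  split_ifs
  · exact div_nonneg (hw u) (sub_nonneg.2 hv.le)
  · exact hw u

theorem IsElimOrder.indepValue_pos [DecidableEq V] {w : V → K} {l : List V}
    (h : IsElimOrder G l) (hf : Feasible G l w) : 0 < indepValue G w l.toFinset := by
  induction l generalizing w with
  | nil => simp
  | cons v l ih =>
    rw [h.indepValue_cons hf.1.ne]
    exact mul_pos (sub_pos.2 hf.1) (ih h.2.2 hf.2)

theorem IsElimOrder.exists_prefix_indepValue_nonpos [DecidableEq V] {w : V → K} {l : List V}
    (h : IsElimOrder G l) (hf : ¬ Feasible G l w) :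
    ∃ l', l' <+: l ∧ indepValue G w l'.toFinset ≤ 0 := by
  induction l generalizing w with
  | nil => exact absurd trivial hf
  | cons v l ih =>
    by_cases hv : w v < 1
    · obtain ⟨l', hl', hle⟩ := ih h.2.2 (w := reweight G v w) fun h' => hf ⟨hv, h'⟩
      refine ⟨v :: l', by simpa using hl', ?_⟩
      rw [(h.sublist (hl'.sublist.cons_cons v)).indepValue_cons hv.ne]
      exact mul_nonpos_of_nonneg_of_nonpos (sub_nonneg.2 hv.le) hle
    · refine ⟨[v], by simp, ?_⟩
      rw [List.toFinset_cons, List.toFinset_nil, indepValue_insert _ (Finset.notMem_empty _)]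
      simpa using hv

end Elimination

theorem exists_int_indepValue {V : Type*} (G : SimpleGraph V) (S : Finset V) {a b : ℕ}
    (hb : b ≠ 0) :
    ∃ N : ℤ, indepValue G (fun _ => (a : ℚ) / b) S * (b : ℚ) ^ S.card = N ∧
      |N| ≤ ((a + b : ℕ) : ℤ) ^ S.card := by
  classical
  have : (b : ℚ) ≠ 0 := Nat.cast_ne_zero.2 hb
  refine ⟨∑ I ∈ indepSubsets G S,
    (-a : ℤ) ^ I.card * (b : ℤ) ^ (S.card - I.card), ?_, ?_⟩
  · rw [indepValue, Finset.sum_mul, Int.cast_sum]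
    refine Finset.sum_congr rfl fun I hI => ?_
    have hIS := Finset.card_le_card (mem_indepSubsets.1 hI).1
    rw [Finset.prod_const, ← Nat.sub_add_cancel hIS, pow_add, ← neg_div, div_pow,
      Nat.sub_add_cancel hIS]
    push_cast
    field_simp
  · calc _ ≤ ∑ I ∈ indepSubsets G S, |(-a : ℤ) ^ I.card * (b : ℤ) ^ (S.card - I.card)| :=
        Finset.abs_sum_le_sum_abs _ _
      _ ≤ ∑ I ∈ S.powerset, |(-a : ℤ) ^ I.card * (b : ℤ) ^ (S.card - I.card)| :=
        Finset.sum_le_sum_of_subset_of_nonneg (Finset.filter_subset _ _)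
          fun _ _ _ => abs_nonneg _
      _ = ∑ I ∈ S.powerset, (a : ℤ) ^ I.card * (b : ℤ) ^ (S.card - I.card) := by
        simp [abs_mul, abs_pow]
      _ = ((a + b : ℕ) : ℤ) ^ S.card := by
        rw [Finset.sum_pow_mul_eq_add_pow, Nat.cast_add]

/-! ### Feasible weights: the bears lose -/

section Avoidance

variable {V K : Type*} {G : SimpleGraph V} [Field K] [LinearOrder K] [IsStrictOrderedRing K]
  [DecidableEq V]

/-- The properties of the number `N W` of outcomes that avoid all bad events in `W`, when an event
`u ∈ S` has conditional probability at most `w u` given that events not adjacent to it are avoided,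
as in the lopsided local lemma. -/
structure IsAvoidanceCount (G : SimpleGraph V) (S : Finset V) (w : V → K) (N : Finset V → K) :
    Prop where
  supermodular (u v : V) (W : Finset V) :
    N (insert u W) + N (insert v W) ≤ N W + N (insert u (insert v W))
  le_insert (u : V) (hu : u ∈ S) (W : Finset V) (hW : W ⊆ S) (huW : u ∉ W)
    (hadj : ∀ x ∈ W, ¬ G.Adj u x) : (1 - w u) * N W ≤ N (insert u W)

variable {S : Finset V} {w : V → K} {N : Finset V → K} {u v : V}

/-- Of the two instances of `le_insert` used here, the one for `v` turns the loss `w u * N W` into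
`w u / (1 - w v) * N (insert v W)`. -/
theorem IsAvoidanceCount.le_insert_insert (hN : IsAvoidanceCount G S w N) {W : Finset V}
    (hw : 0 ≤ w u) (hv1 : w v < 1) (hu : u ∈ S) (hv : v ∈ S) (hW : W ⊆ S) (huW : u ∉ W)
    (hvW : v ∉ W) (hua : ∀ x ∈ W, ¬ G.Adj u x) (hva : ∀ x ∈ W, ¬ G.Adj v x) :
    (1 - w u / (1 - w v)) * N (insert v W) ≤ N (insert v (insert u W)) := by
  have hv1 : 0 < 1 - w v := sub_pos.2 hv1
  have hloss : w u * N W ≤ w u / (1 - w v) * N (insert v W) := by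
    rw [div_mul_eq_mul_div, le_div_iff₀ hv1, mul_assoc, mul_comm (N W)]
    exact mul_le_mul_of_nonneg_left (hN.le_insert v hv W hW hvW hva) hw
  have hsuper := hN.supermodular v u W
  have hle := hN.le_insert u hu W hW huW hua
  linarith

theorem IsAvoidanceCount.reweight (hN : IsAvoidanceCount G (insert v S) w N) (hvS : v ∉ S)
    (hs : IsSimplicialIn G S v) (hv1 : w v < 1) (hw : ∀ u, 0 ≤ w u) :
    IsAvoidanceCount G S (reweight G v w) fun W => N (insert v W) where
  supermodular a b W := by
    simpa only [Finset.insert_comm v] using hN.supermodular a b (insert v W)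
  le_insert u hu W hW huW hadj := by
    have hvW : v ∉ W := fun h => hvS (hW h)
    have hW' : W ⊆ insert v S := hW.trans (Finset.subset_insert v S)
    have hu' : u ∈ insert v S := Finset.mem_insert_of_mem hu
    unfold HatGuessing.reweight
    split_ifs with hvu
    · refine hN.le_insert_insert (hw u) hv1 hu' (Finset.mem_insert_self v S) hW' huW hvW hadj
        fun x hx hvx => hadj x hx ?_
      exact hs ⟨hu, hvu⟩ ⟨hW hx, hvx⟩ fun h => huW (h ▸ hx)
    · rw [Finset.insert_comm]
      refine hN.le_insert u hu' (insert v W) (Finset.insert_subset_insert v hW) ?_ ?_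
      · rw [Finset.mem_insert, not_or]
        exact ⟨fun h => hvS (h ▸ hu), huW⟩
      · rw [Finset.forall_mem_insert]
        exact ⟨fun h => hvu h.symm, hadj⟩

theorem IsAvoidanceCount.pos_of_feasible {l : List V} (hN : IsAvoidanceCount G l.toFinset w N)
    (hl : IsElimOrder G l) (hf : Feasible G l w) (hw : ∀ u, 0 ≤ w u) (h0 : 0 < N ∅) :
    0 < N l.toFinset := by
  induction l generalizing w N with
  | nil => simpa using h0
  | cons v l ih =>
    have hpos : 0 < N (insert v ∅) :=
      (mul_pos (sub_pos.2 hf.1) h0).trans_le (hN.le_insert v (by simp) ∅ (by simp) (by simp)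
        (by simp))
    rw [List.toFinset_cons] at hN ⊢
    exact ih (hN.reweight (mt List.mem_toFinset.1 hl.1)
      (hl.2.1.mono fun x hx => List.mem_toFinset.1 hx.1) hf.1 hw) hl.2.2 hf.2
      (reweight_nonneg hw hf.1) hpos

end Avoidance

section Losing

variable {V : Type*} {G : SimpleGraph V} {h g : ℕ}

/-- The colors guessed by the bear on `v` when the hats are arranged as in `φ`. -/
def guesses (Γ : Strategy G h g) (φ : V → Fin h) (v : V) : Finset (Fin h) :=
  (Γ v fun u => φ u).val

theorem card_guesses (Γ : Strategy G h g) (φ : V → Fin h) (v : V) : (guesses Γ φ v).card = g :=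
  (Γ v fun u => φ u).2

theorem guesses_update [DecidableEq V] (Γ : Strategy G h g) (φ : V → Fin h) {u v : V}
    (huv : ¬ G.Adj v u) (c : Fin h) : guesses Γ (Function.update φ u c) v = guesses Γ φ v := by
  have hsee : (fun x : G.neighborSet v => Function.update φ u c x) =
      fun x : G.neighborSet v => φ x := by
    funext x
    have hxu : (x : V) ≠ u := fun h => huv (h ▸ x.2)
    exact Function.update_of_ne hxu c φ
  rw [guesses, hsee, guesses]

/-- Recoloring `u` by `c` maps a pair of an arrangement with a right guess on `u` and a color `c` to
an arrangement together with one of the `g` guesses on `u`. -/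
theorem mul_card_filter_mem_guesses_le [DecidableEq V] (Γ : Strategy G h g) (u : V)
    {E : Finset (V → Fin h)} (hE : ∀ φ ∈ E, ∀ c, Function.update φ u c ∈ E) :
    h * (E.filter fun φ => φ u ∈ guesses Γ φ u).card ≤ g * E.card := by
  have hcard : (E.sigma fun φ => guesses Γ φ u).card = g * E.card := by
    rw [Finset.card_sigma, Finset.sum_congr rfl fun φ _ => card_guesses Γ φ u, Finset.sum_const,
      smul_eq_mul, mul_comm]
  have hprod : h * (E.filter fun φ => φ u ∈ guesses Γ φ u).card =
      ((E.filter fun φ => φ u ∈ guesses Γ φ u) ×ˢ (Finset.univ : Finset (Fin h))).card := by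
    rw [Finset.card_product, Finset.card_fin, mul_comm]
  rw [← hcard, hprod]
  refine Finset.card_le_card_of_injOn (fun q => ⟨Function.update q.1 u q.2, q.1 u⟩) ?_ ?_
  · rintro ⟨φ, c⟩ hφc
    obtain ⟨hφ, hguess⟩ := Finset.mem_filter.1 (Finset.mem_product.1 hφc).1
    rw [Finset.mem_coe, Finset.mem_sigma, guesses_update Γ φ (G.irrefl) c]
    exact ⟨hE φ hφ c, hguess⟩
  · rintro ⟨φ, c⟩ - ⟨ψ, d⟩ - hq
    simp only [Sigma.mk.injEq, heq_eq_eq] at hq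
    obtain ⟨hupdate, hu⟩ := hq
    have hcd : c = d := by simpa using congrFun hupdate u
    have hφψ : φ = ψ := by
      have hrecolor := congrArg (fun χ => Function.update χ u (φ u)) hupdate
      simpa only [Function.update_idem, Function.update_eq_self, hu ▸ Function.update_eq_self u ψ]
        using hrecolor
    rw [hφψ, hcd]

variable [Fintype V]

open Classical in
/-- The hat arrangements for which all bears of `X` guess wrong. -/
noncomputable def allWrong (Γ : Strategy G h g) (X : Finset V) : Finset (V → Fin h) :=
  Finset.univ.filter fun φ => ∀ v ∈ X, φ v ∉ guesses Γ φ v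

theorem mem_allWrong {Γ : Strategy G h g} {X : Finset V} {φ : V → Fin h} :
    φ ∈ allWrong Γ X ↔ ∀ v ∈ X, φ v ∉ guesses Γ φ v := by
  simp [allWrong]

theorem update_mem_allWrong [DecidableEq V] {Γ : Strategy G h g} {u : V} {W : Finset V}
    (huW : u ∉ W) (hadj : ∀ x ∈ W, ¬ G.Adj u x) {φ : V → Fin h} (hφ : φ ∈ allWrong Γ W)
    (c : Fin h) : Function.update φ u c ∈ allWrong Γ W := by
  rw [mem_allWrong] at hφ ⊢
  intro v hv
  have hvu : v ≠ u := fun h => huW (h ▸ hv)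
  rw [guesses_update Γ φ (fun h => hadj v hv h.symm), Function.update_of_ne hvu]
  exact hφ v hv

theorem card_allWrong_insert [DecidableEq V] (Γ : Strategy G h g) (hh : 0 < h) {u : V}
    {W : Finset V} (huW : u ∉ W) (hadj : ∀ x ∈ W, ¬ G.Adj u x) :
    (1 - (g : ℚ) / h) * (allWrong Γ W).card ≤ (allWrong Γ (insert u W)).card := by
  have hright : (h : ℚ) * ((allWrong Γ W).filter fun φ => φ u ∈ guesses Γ φ u).card ≤
      g * (allWrong Γ W).card := by
    exact_mod_cast mul_card_filter_mem_guesses_le Γ u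
      fun φ hφ c => update_mem_allWrong huW hadj hφ c
  have hwrong : (allWrong Γ W).filter (fun φ => φ u ∉ guesses Γ φ u) =
      allWrong Γ (insert u W) := by
    ext φ
    simp only [Finset.mem_filter, mem_allWrong, Finset.forall_mem_insert, and_comm]
  have hsplit : (((allWrong Γ W).filter fun φ => φ u ∈ guesses Γ φ u).card : ℚ) +
      (allWrong Γ (insert u W)).card = (allWrong Γ W).card := by
    rw [← hwrong]
    exact_mod_cast Finset.card_filter_add_card_filter_not _
  have hfreq : (((allWrong Γ W).filter fun φ => φ u ∈ guesses Γ φ u).card : ℚ) ≤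
      (g : ℚ) / h * (allWrong Γ W).card := by
    rw [div_mul_eq_mul_div, le_div_iff₀ (Nat.cast_pos.2 hh), mul_comm]
    exact hright
  linarith

theorem card_allWrong_supermodular [DecidableEq V] (Γ : Strategy G h g) (u v : V) (W : Finset V) :
    (allWrong Γ (insert u W)).card + (allWrong Γ (insert v W)).card ≤
      (allWrong Γ W).card + (allWrong Γ (insert u (insert v W))).card := by
  classical
  rw [← Finset.card_union_add_card_inter]
  gcongr <;> intro φ
  · simp only [Finset.mem_union, mem_allWrong, Finset.forall_mem_insert]
    tauto
  · simp only [Finset.mem_inter, mem_allWrong, Finset.forall_mem_insert]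
    tauto

theorem isAvoidanceCount_card_allWrong [DecidableEq V] (Γ : Strategy G h g) (hh : 0 < h)
    (S : Finset V) {w : V → ℚ} (hw : ∀ u ∈ S, (g : ℚ) / h ≤ w u) :
    IsAvoidanceCount G S w fun W => ((allWrong Γ W).card : ℚ) where
  supermodular u v W := by exact_mod_cast card_allWrong_supermodular Γ u v W
  le_insert u hu W _ huW hadj := by
    refine le_trans ?_ (card_allWrong_insert Γ hh huW hadj)
    gcongr
    exact hw u hu

theorem IsWinningGame.le_card_mul (hwin : IsWinningGame G h g) (hh : 0 < h) :
    h ≤ Fintype.card V * g := by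
  classical
  obtain ⟨Γ, hΓ⟩ := hwin
  have : NeZero h := ⟨hh.ne'⟩
  let right (u : V) : Finset (V → Fin h) := Finset.univ.filter fun φ => φ u ∈ guesses Γ φ u
  have hcover : (Finset.univ : Finset (V → Fin h)) ⊆ Finset.univ.biUnion right := fun φ _ => by
    obtain ⟨v, hv⟩ := hΓ φ
    exact Finset.mem_biUnion.2
      ⟨v, Finset.mem_univ v, Finset.mem_filter.2 ⟨Finset.mem_univ φ, hv⟩⟩
  refine Nat.le_of_mul_le_mul_right (c := Fintype.card (V → Fin h)) ?_ Fintype.card_pos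
  calc h * Fintype.card (V → Fin h)
      ≤ h * ∑ u, (right u).card :=
        Nat.mul_le_mul_left h ((Finset.card_le_card hcover).trans Finset.card_biUnion_le)
    _ = ∑ u, h * (right u).card := Finset.mul_sum _ _ _
    _ ≤ ∑ _u : V, g * Fintype.card (V → Fin h) :=
        Finset.sum_le_sum fun u _ => mul_card_filter_mem_guesses_le Γ u fun _ _ _ =>
          Finset.mem_univ _
    _ = Fintype.card V * g * Fintype.card (V → Fin h) := by
        rw [Finset.sum_const, Finset.card_univ, smul_eq_mul, mul_assoc]

end Losing

/-! ### Infeasible weights: the bears win -/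

section Winning

variable {V C : Type*} {G : SimpleGraph V} {S : Finset V} {w : V → ℚ} {v : V}

/-- The bears of `S` are sure that one of them guesses correctly, using the colors `C` and the rule
`Γ`, where the bear on `v` guesses at most the fraction `w v` of all colors. For convenience `Γ v`
depends on the whole hat arrangement; the condition `eq_of_forall_adj` makes it legal. -/
structure IsWinningRule [Fintype C] (G : SimpleGraph V) (S : Finset V) (w : V → ℚ)
    (Γ : V → (V → C) → Finset C) : Prop where
  eq_of_forall_adj (v : V) (hv : v ∈ S) (φ ψ : V → C) (h : ∀ u, G.Adj v u → φ u = ψ u) :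
    Γ v φ = Γ v ψ
  card_le (v : V) (hv : v ∈ S) (φ : V → C) : ((Γ v φ).card : ℚ) ≤ w v * Fintype.card C
  exists_mem (φ : V → C) : ∃ v ∈ S, φ v ∈ Γ v φ

/-- The bears of `S` have a winning rule with guessing fractions `w` for some set of colors. -/
def WinsOn (G : SimpleGraph V) (S : Finset V) (w : V → ℚ) : Prop :=
  ∃ (C : Type) (_ : Fintype C) (_ : Nonempty C) (Γ : V → (V → C) → Finset C),
    IsWinningRule G S w Γ

theorem winsOn_of_one_le (hw : ∀ u, 0 ≤ w u) (hvS : v ∈ S) (hv : 1 ≤ w v) : WinsOn G S w := by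
  classical
  refine ⟨Unit, inferInstance, inferInstance, fun u _ => if u = v then Finset.univ else ∅,
    fun _ _ _ _ _ => rfl, fun u _ _ => ?_, fun _ => ⟨v, hvS, by simp⟩⟩
  split_ifs with h
  · simpa [h] using hv
  · simpa using hw u

section SumRule

variable {Z : Type*} [AddCommGroup Z] [Fintype Z] [DecidableEq Z] [DecidableEq V] {M : Finset V}
  {T : Finset Z} {u : V}

/-- The values for `u` that bring the sum over `M` into `T` when all other values are as in `φ`. -/
def completions (M : Finset V) (T : Finset Z) (φ : V → Z) (u : V) : Finset Z :=
  Finset.univ.filter fun z => ∑ x ∈ M, Function.update φ u z x ∈ T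

theorem self_mem_completions {φ : V → Z} : φ u ∈ completions M T φ u ↔ ∑ x ∈ M, φ x ∈ T := by
  simp [completions]

theorem completions_congr {φ ψ : V → Z} (h : ∀ x ∈ M, x ≠ u → φ x = ψ x) :
    completions M T φ u = completions M T ψ u := by
  have hsum (z : Z) : ∑ x ∈ M, Function.update φ u z x = ∑ x ∈ M, Function.update ψ u z x := by
    refine Finset.sum_congr rfl fun x hx => ?_
    rcases eq_or_ne x u with rfl | hxu
    · simp only [Function.update_self]
    · simp only [Function.update_of_ne hxu, h x hx hxu]
  simp only [completions, hsum]

theorem card_completions (hu : u ∈ M) (φ : V → Z) : (completions M T φ u).card = T.card := by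
  have hmap : completions M T φ u =
      T.map (Equiv.subRight (∑ x ∈ M.erase u, φ x)).toEmbedding := by
    ext z
    rw [Finset.mem_map_equiv, completions, Finset.mem_filter_univ,
      Finset.sum_update_of_mem hu, Finset.sdiff_singleton_eq_erase]
    simp
  rw [hmap, Finset.card_map]

variable [Fintype C]

/-- The rule on colors `C × Z` in which `v` bets that the sum over `M` of the `Z`-parts lies in `T`,
while the other bears of `M` bet against it and all bears but `v` guess the `C`-part by `Γ`. -/
def sumRule (M : Finset V) (v : V) (T : Finset Z) (Γ : V → (V → C) → Finset C) (u : V)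
    (φ : V → C × Z) : Finset (C × Z) :=
  if u = v then Finset.univ ×ˢ completions M T (fun x => (φ x).2) u
  else Γ u (fun x => (φ x).1) ×ˢ
    if u ∈ M then completions M Tᶜ (fun x => (φ x).2) u else Finset.univ

theorem sumRule_congr {Γ : V → (V → C) → Finset C} (hs : IsSimplicialIn G S v)
    (hM : ∀ u, u ∈ M ↔ u = v ∨ u ∈ S ∧ G.Adj v u) (hΓ : IsWinningRule G S w Γ)
    (hu : u ∈ insert v S) {φ ψ : V → C × Z} (hφψ : ∀ x, G.Adj u x → φ x = ψ x) :
    sumRule M v T Γ u φ = sumRule M v T Γ u ψ := by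
  have hadj : u ∈ M → ∀ x ∈ M, x ≠ u → G.Adj u x := by
    simp only [hM]
    rintro (rfl | ⟨huS, hvu⟩) x (rfl | ⟨hxS, hvx⟩) hxu
    · exact absurd rfl hxu
    · exact hvx
    · exact hvu.symm
    · exact hs ⟨huS, hvu⟩ ⟨hxS, hvx⟩ hxu.symm
  have hcompl (A : Finset Z) (huM : u ∈ M) :
      completions M A (fun x => (φ x).2) u = completions M A (fun x => (ψ x).2) u :=
    completions_congr fun x hx hxu => by rw [hφψ x (hadj huM x hx hxu)]
  unfold sumRule
  split_ifs with huv huM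
  · rw [hcompl T ((hM u).2 (.inl huv))]
  all_goals
    rw [hΓ.eq_of_forall_adj u ((Finset.mem_insert.1 hu).resolve_left huv) _ (fun x => (ψ x).1)
      fun x hx => by rw [hφψ x hx]]
  rw [hcompl Tᶜ huM]

theorem card_sumRule_le {Γ : V → (V → C) → Finset C} (hv : w v < 1)
    (hT : (T.card : ℚ) = w v * Fintype.card Z) (hM : ∀ u, u ∈ M ↔ u = v ∨ u ∈ S ∧ G.Adj v u)
    (hΓ : IsWinningRule G S (reweight G v w) Γ) (hu : u ∈ insert v S) (φ : V → C × Z) :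
    ((sumRule M v T Γ u φ).card : ℚ) ≤ w u * Fintype.card (C × Z) := by
  unfold sumRule
  rw [Fintype.card_prod, Nat.cast_mul]
  split_ifs with huv huM
  · rw [Finset.card_product, card_completions ((hM u).2 (.inl huv)), Finset.card_univ,
      Nat.cast_mul, hT, huv, mul_left_comm]
  all_goals
    have hcard := hΓ.card_le u ((Finset.mem_insert.1 hu).resolve_left huv) fun x => (φ x).1
    rw [Finset.card_product, Nat.cast_mul]
  · have hvu := (((hM u).1 huM).resolve_left huv).2
    have hTc : (Tᶜ.card : ℚ) = (1 - w v) * Fintype.card Z := by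
      rw [Finset.card_compl, Nat.cast_sub (Finset.card_le_univ T), hT, sub_mul, one_mul]
    have hv0 : 0 < 1 - w v := sub_pos.2 hv
    rw [reweight, if_pos hvu] at hcard
    rw [card_completions huM, hTc]
    calc _ ≤ w u / (1 - w v) * Fintype.card C * ((1 - w v) * Fintype.card Z) := by gcongr
      _ = _ := by field_simp
  · have huS := (Finset.mem_insert.1 hu).resolve_left huv
    rw [reweight, if_neg fun hvu => huM ((hM u).2 (.inr ⟨huS, hvu⟩))] at hcard
    rw [Finset.card_univ, ← mul_assoc]
    gcongr

theorem IsWinningRule.sumRule {Γ : V → (V → C) → Finset C} (hvS : v ∉ S)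
    (hs : IsSimplicialIn G S v) (hv : w v < 1) (hT : (T.card : ℚ) = w v * Fintype.card Z)
    (hM : ∀ u, u ∈ M ↔ u = v ∨ u ∈ S ∧ G.Adj v u) (hΓ : IsWinningRule G S (reweight G v w) Γ) :
    IsWinningRule G (insert v S) w (sumRule M v T Γ) where
  eq_of_forall_adj _ hu _ _ hφψ := sumRule_congr hs hM hΓ hu hφψ
  card_le _ hu φ := card_sumRule_le hv hT hM hΓ hu φ
  exists_mem φ := by
    by_cases hsum : ∑ x ∈ M, (φ x).2 ∈ T
    · refine ⟨v, Finset.mem_insert_self v S, ?_⟩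
      rw [HatGuessing.sumRule, if_pos rfl, Finset.mem_product]
      exact ⟨Finset.mem_univ _, self_mem_completions.2 hsum⟩
    · obtain ⟨u, huS, hu⟩ := hΓ.exists_mem fun x => (φ x).1
      refine ⟨u, Finset.mem_insert_of_mem huS, ?_⟩
      rw [HatGuessing.sumRule, if_neg fun huv : u = v => hvS (huv ▸ huS), Finset.mem_product]
      refine ⟨hu, ?_⟩
      split_ifs
      · exact self_mem_completions.2 (Finset.mem_compl.2 hsum)
      · exact Finset.mem_univ _

end SumRule

theorem WinsOn.insert [DecidableEq V] (hvS : v ∉ S) (hs : IsSimplicialIn G S v)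
    (hw : 0 ≤ w v) (hv : w v < 1) (hwin : WinsOn G S (reweight G v w)) :
    WinsOn G (insert v S) w := by
  classical
  obtain ⟨C, _, _, Γ, hΓ⟩ := hwin
  obtain ⟨q, hq⟩ : ∃ q : ℚ≥0, (q : ℚ) = w v := ⟨⟨w v, hw⟩, rfl⟩
  have : NeZero q.den := ⟨q.den_ne_zero⟩
  have hden : (q.den : ℚ≥0) ≠ 0 := Nat.cast_ne_zero.2 q.den_ne_zero
  have hnum : (q.num : ℚ≥0) = q * q.den := by rw [← div_eq_iff hden, NNRat.num_div_den]
  have hle : q.num ≤ (Finset.univ : Finset (ZMod q.den)).card := by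
    rw [Finset.card_univ, ZMod.card, ← Nat.cast_le (α := ℚ≥0), hnum]
    have hq1 : q ≤ 1 := by exact_mod_cast (hq.trans_lt hv).le
    exact mul_le_of_le_one_left' hq1
  obtain ⟨T, -, hT⟩ := Finset.exists_subset_card_eq hle
  refine ⟨C × ZMod q.den, inferInstance, inferInstance, _,
    hΓ.sumRule (T := T) (M := Insert.insert v (S.filter (G.Adj v))) hvS hs hv ?_ (by simp)⟩
  rw [hT, ZMod.card, ← hq]
  exact_mod_cast hnum

theorem IsElimOrder.winsOn [DecidableEq V] {l : List V} (hl : IsElimOrder G l)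
    (hw : ∀ u, 0 ≤ w u) (hf : ¬ Feasible G l w) : WinsOn G l.toFinset w := by
  induction l generalizing w with
  | nil => exact absurd trivial hf
  | cons v l ih =>
    rw [List.toFinset_cons]
    by_cases hv : w v < 1
    · exact WinsOn.insert (mt List.mem_toFinset.1 hl.1)
        (hl.2.1.mono fun x hx => List.mem_toFinset.1 hx.1) (hw v) hv
        (ih hl.2.2 (reweight_nonneg hw hv) fun h => hf ⟨hv, h⟩)
    · exact winsOn_of_one_le hw (Finset.mem_insert_self v _) (not_lt.1 hv)

theorem IsWinningRule.prod [Fintype C] {Γ : V → (V → C) → Finset C} (hΓ : IsWinningRule G S w Γ)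
    (D : Type*) [Fintype D] :
    IsWinningRule G S w fun v (φ : V → C × D) => Γ v (fun u => (φ u).1) ×ˢ Finset.univ where
  eq_of_forall_adj v hv φ ψ h := by
    rw [hΓ.eq_of_forall_adj v hv _ (fun u => (ψ u).1) fun u hu => by rw [h u hu]]
  card_le v hv φ := by
    rw [Finset.card_product, Fintype.card_prod, Finset.card_univ, Nat.cast_mul, Nat.cast_mul,
      ← mul_assoc]
    gcongr
    exact hΓ.card_le v hv _
  exists_mem φ := by
    obtain ⟨v, hv, hφ⟩ := hΓ.exists_mem fun u => (φ u).1
    exact ⟨v, hv, Finset.mem_product.2 ⟨hφ, Finset.mem_univ _⟩⟩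

theorem IsWinningRule.isWinningGame [Fintype C] [Nonempty C] {Γ : V → (V → C) → Finset C}
    (hΓ : IsWinningRule G S w Γ) (hS : ∀ v, v ∈ S) {h g : ℕ} (hh : Fintype.card C = h)
    (hgh : g ≤ h) (hg : ∀ v, w v * h ≤ g) : IsWinningGame G h g := by
  classical
  let e : C ≃ Fin h := Fintype.equivFinOfCardEq hh
  let seen (v : V) (φ : G.neighborSet v → Fin h) (u : V) : C :=
    if hu : G.Adj v u then e.symm (φ ⟨u, hu⟩) else Classical.arbitrary C
  have hA (v : V) (φ : G.neighborSet v → Fin h) :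
      ∃ A : Finset (Fin h), (Γ v (seen v φ)).map e.toEmbedding ⊆ A ∧ A.card = g := by
    refine Finset.exists_superset_card_eq ?_ (by rwa [Fintype.card_fin])
    rw [Finset.card_map]
    have hcard := hΓ.card_le v (hS v) (seen v φ)
    rw [hh] at hcard
    exact_mod_cast hcard.trans (hg v)
  choose A hsub hcard using hA
  refine ⟨fun v φ => ⟨A v φ, hcard v φ⟩, fun φ => ?_⟩
  obtain ⟨v, hv, hmem⟩ := hΓ.exists_mem fun u => e.symm (φ u)
  refine ⟨v, hsub v _ (Finset.mem_map_equiv.2 ?_)⟩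
  rwa [hΓ.eq_of_forall_adj v hv (seen v fun u => φ u) (fun u => e.symm (φ u))
    fun u hu => dif_pos hu]

theorem WinsOn.isWinningGame {h g : ℕ} (hh : 0 < h) (hgh : g ≤ h) (hS : ∀ v, v ∈ S)
    (hwin : WinsOn G S fun _ => (g : ℚ) / h) :
    ∃ c, 0 < c ∧ IsWinningGame G (c * h) (c * g) := by
  obtain ⟨C, _, _, Γ, hΓ⟩ := hwin
  have : NeZero h := ⟨hh.ne'⟩
  refine ⟨Fintype.card C, Fintype.card_pos, (hΓ.prod (Fin h)).isWinningGame hS (by simp)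
    (Nat.mul_le_mul_left _ hgh) fun _ => le_of_eq ?_⟩
  push_cast
  field_simp

end Winning

/-! ### The fractional hat chromatic number -/

section FracHat

open Filter Polynomial Topology

variable {V : Type*} {G : SimpleGraph V} {l : List V}

theorem eventually_feasible {w : ℚ → V → ℚ} {x₀ : ℚ} (hw : ∀ u, ContinuousAt (fun x => w x u) x₀)
    (hf : Feasible G l (w x₀)) : ∀ᶠ x in 𝓝 x₀, Feasible G l (w x) := by
  induction l generalizing w with
  | nil => exact .of_forall fun _ => trivial
  | cons v l ih =>
    refine ((hw v).eventually_lt continuousAt_const hf.1).and (ih (fun u => ?_) hf.2)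
    unfold reweight
    split_ifs
    · exact (hw u).div (continuousAt_const.sub (hw v)) (sub_pos.2 hf.1).ne'
    · exact hw u

theorem isWinningGame_one_one [Nonempty V] (G : SimpleGraph V) : IsWinningGame G 1 1 :=
  ⟨fun _ _ => ⟨Finset.univ, by simp⟩, fun _ => ⟨Classical.arbitrary V, Finset.mem_univ _⟩⟩

theorem fracHatNumber_le [Nonempty V] {B : ℝ}
    (hB : ∀ h g : ℕ, 0 < h → 0 < g → IsWinningGame G h g → (h : ℝ) / g ≤ B) :
    fracHatNumber G ≤ B := by
  refine csSup_le ⟨_, 1, 1, one_pos, one_pos, isWinningGame_one_one G, rfl⟩ ?_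
  rintro x ⟨h, g, hh, hg, hwin, rfl⟩
  exact hB h g hh hg hwin

theorem IsWinningGame.div_le_card [Fintype V] {h g : ℕ} (hwin : IsWinningGame G h g) (hh : 0 < h)
    (hg : 0 < g) : (h : ℝ) / g ≤ Fintype.card V := by
  rw [div_le_iff₀ (Nat.cast_pos.2 hg)]
  exact_mod_cast hwin.le_card_mul hh

theorem fracHatNumber_le_card [Fintype V] [Nonempty V] (G : SimpleGraph V) :
    fracHatNumber G ≤ Fintype.card V :=
  fracHatNumber_le fun _ _ hh hg hwin => hwin.div_le_card hh hg

variable [Finite V]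

theorem IsElimOrder.not_isWinningGame (hl : IsElimOrder G l) (hall : ∀ v, v ∈ l)
    {h g : ℕ} {x : ℚ} (hf : Feasible G l fun _ => x) (hh : 0 < h) (hg : (g : ℚ) / h ≤ x) :
    ¬ IsWinningGame G h g := by
  classical
  have := Fintype.ofFinite V
  rintro ⟨Γ, hΓ⟩
  have hempty : (allWrong Γ ∅).Nonempty := ⟨fun _ => ⟨0, hh⟩, by simp [mem_allWrong]⟩
  have hpos := (isAvoidanceCount_card_allWrong Γ hh l.toFinset fun _ _ => hg).pos_of_feasible hl hf
    (fun _ => (by positivity : (0 : ℚ) ≤ g / h).trans hg) (Nat.cast_pos.2 hempty.card_pos)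
  obtain ⟨φ, hφ⟩ := Finset.card_pos.1 (Nat.cast_pos.1 hpos)
  obtain ⟨v, hv⟩ := hΓ φ
  exact mem_allWrong.1 hφ v (List.mem_toFinset.2 (hall v)) hv

theorem IsWinningGame.le_fracHatNumber {h g : ℕ} (hwin : IsWinningGame G h g) (hh : 0 < h)
    (hg : 0 < g) : (h : ℝ) / g ≤ fracHatNumber G := by
  have := Fintype.ofFinite V
  refine le_csSup ⟨Fintype.card V, ?_⟩ ⟨h, g, hh, hg, hwin, rfl⟩
  rintro x ⟨h, g, hh, hg, hwin, rfl⟩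
  exact hwin.div_le_card hh hg

variable [Nonempty V]

theorem one_le_fracHatNumber (G : SimpleGraph V) : 1 ≤ fracHatNumber G := by
  simpa using (isWinningGame_one_one G).le_fracHatNumber one_pos one_pos

theorem IsElimOrder.fracHatNumber_lt (hl : IsElimOrder G l) (hall : ∀ v, v ∈ l) {y : ℚ}
    (hy : 0 < y) (hf : Feasible G l fun _ => y⁻¹) : fracHatNumber G < y := by
  obtain ⟨x, hyx, hx⟩ := (eventually_feasible (fun _ => continuousAt_id) hf).exists_gt
  have hx0 : 0 < x := (inv_pos.2 hy).trans hyx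
  have hle : fracHatNumber G ≤ ((x⁻¹ : ℚ) : ℝ) := by
    refine fracHatNumber_le fun h g hh _ hwin => ?_
    by_contra! hlt
    rw [← Rat.cast_natCast h, ← Rat.cast_natCast g, ← Rat.cast_div, Rat.cast_lt] at hlt
    refine hl.not_isWinningGame hall hx hh ?_ hwin
    rw [← inv_div]
    exact (inv_lt_of_inv_lt₀ hx0 hlt).le
  exact hle.trans_lt (Rat.cast_lt.2 (inv_lt_of_inv_lt₀ hy hyx))

theorem IsElimOrder.le_fracHatNumber (hl : IsElimOrder G l) (hall : ∀ v, v ∈ l) {y : ℚ}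
    (hy : 0 < y) (hf : ¬ Feasible G l fun _ => y⁻¹) : (y : ℝ) ≤ fracHatNumber G := by
  classical
  rcases le_total y 1 with hy1 | hy1
  · exact le_trans (by exact_mod_cast hy1) (one_le_fracHatNumber G)
  lift y to ℚ≥0 using hy.le
  have hq : y = (y.num : ℚ≥0) / y.den := (NNRat.num_div_den y).symm
  have hnum : 0 < y.num := NNRat.num_pos.2 (by exact_mod_cast hy)
  have hle : y.den ≤ y.num := by
    have hy1 : 1 ≤ y := by exact_mod_cast hy1
    rw [hq, le_div_iff₀ (Nat.cast_pos.2 y.den_pos), one_mul] at hy1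
    exact_mod_cast hy1
  have hinv : (y : ℚ)⁻¹ = (y.den : ℚ) / y.num := by
    rw [NNRat.cast_def, inv_div]
  rw [hinv] at hf
  obtain ⟨c, hc, hwin⟩ := (hl.winsOn (fun _ => by positivity) hf).isWinningGame hnum hle
    fun v => List.mem_toFinset.2 (hall v)
  have hμ := hwin.le_fracHatNumber (Nat.mul_pos hc hnum) (Nat.mul_pos hc y.den_pos)
  rw [Nat.cast_mul, Nat.cast_mul, mul_div_mul_left _ _ (Nat.cast_ne_zero.2 hc.ne')] at hμ
  rwa [NNRat.cast_def, Rat.cast_div, Rat.cast_natCast, Rat.cast_natCast]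

theorem IsElimOrder.le_fracHatNumber_iff (hl : IsElimOrder G l) (hall : ∀ v, v ∈ l) {y : ℚ}
    (hy : 0 < y) : (y : ℝ) ≤ fracHatNumber G ↔ ¬ Feasible G l fun _ => y⁻¹ :=
  ⟨fun h hf => h.not_gt (hl.fracHatNumber_lt hall hy hf), hl.le_fracHatNumber hall hy⟩

theorem continuous_indepValue {V R : Type*} [CommRing R] [TopologicalSpace R] [IsTopologicalRing R]
    (G : SimpleGraph V) (S : Finset V) : Continuous fun w : V → R => indepValue G w S :=
  continuous_finsetSum _ fun _ _ => continuous_finsetProd _ fun v _ => (continuous_apply v).neg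

theorem IsElimOrder.exists_prefix_indepValue_eq_zero [DecidableEq V] (hl : IsElimOrder G l)
    (hall : ∀ v, v ∈ l) {r : ℚ} (hr : fracHatNumber G = r) :
    ∃ l', l' <+: l ∧ indepValue G (fun _ => r⁻¹) l'.toFinset = 0 := by
  have hr0 : 0 < r := by exact_mod_cast hr ▸ one_pos.trans_le (one_le_fracHatNumber G)
  obtain ⟨l', hl', hle⟩ := hl.exists_prefix_indepValue_nonpos
    ((hl.le_fracHatNumber_iff hall hr0).1 hr.ge)
  refine ⟨l', hl', le_antisymm hle ?_⟩
  have hcont : Continuous fun x : ℚ => indepValue G (fun _ => x) l'.toFinset :=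
    (continuous_indepValue G l'.toFinset).comp (continuous_pi fun _ => continuous_id)
  refine ge_of_tendsto (hcont.continuousWithinAt (s := Set.Iio r⁻¹)) ?_
  filter_upwards [Ioo_mem_nhdsLT (inv_pos.2 hr0)] with x ⟨hx0, hxr⟩
  have hfeas : Feasible G l fun _ => x := by
    by_contra hcon
    rw [← inv_inv x, ← hl.le_fracHatNumber_iff hall (inv_pos.2 hx0), hr, Rat.cast_le] at hcon
    exact hcon.not_gt (lt_inv_of_lt_inv₀ hx0 hxr)
  obtain ⟨l'', rfl⟩ := hl'
  exact ((hl.sublist (List.sublist_append_left l' l'')).indepValue_pos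
    ((feasible_append l' l'' _).1 hfeas).1).le

theorem isIntegral_of_aeval_inv_eq_zero {A K : Type*} [CommRing A] [Field K] [Algebra A K]
    {P : A[X]} (hP : P.coeff 0 = 1) {r : K} (hr : aeval r⁻¹ P = 0) : IsIntegral A r := by
  rcases eq_or_ne r 0 with rfl | hr0
  · exact isIntegral_zero
  have : Nontrivial A := (algebraMap A K).domain_nontrivial
  have : Invertible r⁻¹ := invertibleOfNonzero (inv_ne_zero hr0)
  refine ⟨P.reverse, ?_, ?_⟩
  · rw [Monic, reverse_leadingCoeff, trailingCoeff,
      natTrailingDegree_eq_zero.2 (.inr (hP ▸ one_ne_zero)), hP]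
  · rwa [aeval_def, ← eval₂_reverse_eq_zero_iff, invOf_eq_inv, inv_inv] at hr

theorem IsElimOrder.fracHatNumber_eq_natCast (hl : IsElimOrder G l) (hall : ∀ v, v ∈ l) {r : ℚ}
    (hr : fracHatNumber G = r) : ∃ m : ℕ, fracHatNumber G = m := by
  classical
  obtain ⟨l', -, hroot⟩ := hl.exists_prefix_indepValue_eq_zero hall hr
  let P : ℤ[X] := indepValue G (fun _ => X) l'.toFinset
  have hP0 : P.coeff 0 = 1 := by
    rw [coeff_zero_eq_eval_zero, ← coe_evalRingHom, map_indepValue]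
    simpa using indepValue_zero (R := ℤ) l'.toFinset
  have hP : aeval r⁻¹ P = 0 := by
    rw [← AlgHom.coe_toRingHom, map_indepValue, ← hroot]
    simp
  obtain ⟨z, hz⟩ := IsIntegrallyClosed.isIntegral_iff.1 (isIntegral_of_aeval_inv_eq_zero hP0 hP)
  have hz : (z : ℚ) = r := hz
  rw [← hz, Rat.cast_intCast] at hr
  have hz0 : 0 ≤ z := by exact_mod_cast hr ▸ zero_le_one.trans (one_le_fracHatNumber G)
  lift z to ℕ using hz0
  exact ⟨z, by exact_mod_cast hr⟩

theorem IsChordal.exists_nat_eq_fracHatNumber (hG : IsChordal G)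
    (hμ : ∃ r : ℚ, fracHatNumber G = r) : ∃ m : ℕ, fracHatNumber G = m := by
  have := Fintype.ofFinite V
  obtain ⟨l, hl, hmem⟩ := hG.exists_isElimOrder Finset.univ
  obtain ⟨r, hr⟩ := hμ
  exact hl.fracHatNumber_eq_natCast (fun v => (hmem v).2 (Finset.mem_univ v)) hr

end FracHat

/-! ### Reasoning about programs -/

section Machine

@[simp]
theorem State.reg_setReg (s : State) (x r : ℕ) (q : ℚ) :
    (s.setReg x q).reg r = if r = x then q else s.reg r := by
  simp only [setReg, Function.update_apply]

@[simp]
theorem State.arr_setReg (s : State) (x : ℕ) (q : ℚ) : (s.setReg x q).arr = s.arr := rfl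

@[simp]
theorem State.reg_setArr (s : State) (a i : ℕ) (q : ℚ) : (s.setArr a i q).reg = s.reg := rfl

theorem State.arr_setArr (s : State) (a i a' j : ℕ) (q : ℚ) :
    (s.setArr a i q).arr a' j = if a' = a ∧ j = i then q else s.arr a' j := by
  by_cases h : a' = a
  · subst h
    simp [setArr, Function.update_apply]
  · simp [setArr, h]

@[simp]
theorem State.arr_setArr_of_ne (s : State) {a a' : ℕ} (h : a' ≠ a) (i : ℕ) (q : ℚ) :
    (s.setArr a i q).arr a' = s.arr a' :=
  Function.update_of_ne h _ _

/-- Some instruction in the text of the program has register `r` as its target. The value is a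
`Bool` so that for a concrete program it is found by evaluation. -/
def Prog.writesReg : Prog → ℕ → Bool
  | .skip, _ => false
  | .const x _, r => r == x
  | .arith _ x _ _, r => r == x
  | .load x _ _, r => r == x
  | .store _ _ _, _ => false
  | .seq P Q, r => P.writesReg r || Q.writesReg r
  | .ite _ _ P Q, r => P.writesReg r || Q.writesReg r
  | .loop _ _ P, r => P.writesReg r

/-- Some instruction in the text of the program has the array `a` as its target. -/
def Prog.writesArr : Prog → ℕ → Bool
  | .skip, _ => false
  | .const _ _, _ => false
  | .arith _ _ _ _, _ => false
  | .load _ _ _, _ => false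
  | .store a _ _, a' => a' == a
  | .seq P Q, a => P.writesArr a || Q.writesArr a
  | .ite _ _ P Q, a => P.writesArr a || Q.writesArr a
  | .loop _ _ P, a => P.writesArr a

/-- The states `s` and `s'` agree on every register and every array that `P` does not write. -/
structure Frame (P : Prog) (s s' : State) : Prop where
  reg : ∀ {r}, P.writesReg r = false → s'.reg r = s.reg r
  arr : ∀ {a}, P.writesArr a = false → s'.arr a = s.arr a

theorem Frame.refl (P : Prog) (s : State) : Frame P s s := ⟨fun _ => rfl, fun _ => rfl⟩

theorem Frame.trans {P : Prog} {s s' s'' : State} (h : Frame P s s') (h' : Frame P s' s'') :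
    Frame P s s'' :=
  ⟨fun hr => (h'.reg hr).trans (h.reg hr), fun ha => (h'.arr ha).trans (h.arr ha)⟩

theorem Frame.setReg (s : State) (x : ℕ) (q : ℚ) : Frame (.const x 0) s (s.setReg x q) :=
  ⟨fun hr => by simp_all [Prog.writesReg], fun _ => rfl⟩

variable {b n N T : ℕ} {P P' : Prog} {s s' : State} {Q Q' : State → Prop}

theorem Run.frame {t : ℕ} (h : Run b P s t s') : Frame P s s' :=
  ⟨fun _ => by induction h <;> simp_all [Prog.writesReg],
    fun _ => by induction h <;> simp_all [Prog.writesArr]⟩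

/-- Started in `s`, the program halts within `T` steps in a state with the property `Q`, and it
writes only numbers of bit length at most `b`. -/
def Halts (b T : ℕ) (P : Prog) (s : State) (Q : State → Prop) : Prop :=
  ∃ t s', Run b P s t s' ∧ t ≤ T ∧ Q s'

theorem Halts.mono {T' : ℕ} (h : Halts b T P s Q) (hT : T ≤ T')
    (hQ : ∀ s', Q s' → Frame P s s' → Q' s') : Halts b T' P s Q' := by
  obtain ⟨t, s', hrun, ht, hq⟩ := h
  exact ⟨t, s', hrun, ht.trans hT, hQ s' hq hrun.frame⟩

theorem Halts.seq {T' : ℕ} (h : Halts b T P s fun s' => Halts b T' P' s' Q) :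
    Halts b (T + T') (.seq P P') s Q := by
  obtain ⟨t, s', hrun, ht, t', s'', hrun', ht', hq⟩ := h
  exact ⟨t + t', s'', hrun.seq hrun', add_le_add ht ht', hq⟩

theorem Halts.loop {x y : ℕ} (Inv : ℕ → State → Prop)
    (hstep : ∀ j < N, ∀ s, Inv j s → s.reg x < s.reg y ∧ Halts b T P s (Inv (j + 1)))
    (hend : ∀ s, Inv N s → ¬ s.reg x < s.reg y) {j : ℕ} (hj : j ≤ N) (h : Inv j s) :
    Halts b ((N - j) * (T + 1) + 1) (.loop x y P) s (Inv N) := by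
  induction hj using Nat.decreasingInduction generalizing s with
  | self => exact ⟨1, s, .loop_false (hend s h), Nat.le_add_left _ _, h⟩
  | of_succ j hj ih =>
    obtain ⟨hlt, t, s', hrun, ht, h'⟩ := hstep j hj s h
    obtain ⟨t', s'', hrun', ht', h''⟩ := ih h'
    refine ⟨_, s'', .loop_true hlt hrun hrun', ?_, h''⟩
    rw [show N - j = N - (j + 1) + 1 by omega, Nat.succ_mul]
    omega

/-- `while i < m do (P; i := i + 1)`, on states in which register `2` holds the number one. -/
def Prog.count (i m : ℕ) (P : Prog) : Prog :=
  .loop i m (.seq P (.arith .add i i 2))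

theorem Halts.count {i m : ℕ} (Inv : ℕ → State → Prop) (hwi : P.writesReg i = false)
    (hwm : P.writesReg m = false) (hw2 : P.writesReg 2 = false) (him : m ≠ i) (hi2 : 2 ≠ i)
    (hbit : ∀ j ≤ N, bitLength (j : ℚ) ≤ b) (hm : s.reg m = N) (hone : s.reg 2 = 1)
    (hi : s.reg i = 0) (hirr : ∀ j s q, Inv j s → Inv j (s.setReg i q)) (h0 : Inv 0 s)
    (hstep : ∀ j < N, ∀ s', Inv j s' → s'.reg i = j → Frame (.count i m P) s s' →
      Halts b T P s' (Inv (j + 1))) :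
    Halts b (N * (T + 2) + 1) (.count i m P) s (Inv N) := by
  have frameOf {s' s''} (h : Frame (.seq P (.arith .add i i 2)) s' s'') :
      Frame (.count i m P) s' s'' := ⟨h.reg, h.arr⟩
  have bound {s'} (h : Frame (.count i m P) s s') : s'.reg m = N :=
    (h.reg (by simp [Prog.count, Prog.writesReg, hwm, him])).trans hm
  have unit {s'} (h : Frame (.count i m P) s s') : s'.reg 2 = 1 :=
    (h.reg (by simp [Prog.count, Prog.writesReg, hw2, hi2])).trans hone
  have := Halts.loop (x := i) (y := m) (P := .seq P (.arith .add i i 2)) (T := T + 1) (b := b)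
    (fun j s' => Inv j s' ∧ s'.reg i = j ∧ Frame (.count i m P) s s') (N := N) (s := s)
    (fun j hj s₁ ⟨h, hi₁, hf⟩ => ⟨?_, ?_⟩)
    (fun s₁ ⟨_, hi₁, hf⟩ => by rw [hi₁, bound hf]; exact lt_irrefl _)
    (Nat.zero_le N) ⟨h0, by simpa using hi, Frame.refl _ _⟩
  · exact this.mono le_rfl fun _ h _ => h.1
  · rw [hi₁, bound hf]
    exact_mod_cast hj
  · obtain ⟨t, s₂, hrun, ht, h₂⟩ := hstep j hj s₁ h hi₁ hf
    have hval : Op.add.eval (s₂.reg i) (s₂.reg 2) = ((j + 1 : ℕ) : ℚ) := by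
      rw [hrun.frame.reg hwi, hi₁, hrun.frame.reg hw2, unit hf, Op.eval, Nat.cast_succ]
    have hrun' := hrun.seq (.arith .add i i 2 s₂ (hval ▸ hbit _ hj))
    exact ⟨t + 1, _, hrun', by omega, hirr _ _ _ h₂, by simp [hval],
      hf.trans (frameOf hrun'.frame)⟩

/-- A polynomial whose value at `n` bounds the number of steps of the program if each of its loops
has at most `n` rounds. -/
noncomputable def Prog.cost : Prog → Polynomial ℕ
  | .skip => 1
  | .const _ _ => 1
  | .arith _ _ _ _ => 1
  | .load _ _ _ => 1
  | .store _ _ _ => 1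
  | .seq P Q => P.cost + Q.cost
  | .ite _ _ P Q => P.cost + Q.cost + 1
  | .loop _ _ P => Polynomial.X * (P.cost + 1) + 1

/-- `Halts` with the value at `n` of the cost of the program as time bound. -/
def Does (b n : ℕ) (P : Prog) (s : State) (Q : State → Prop) : Prop :=
  Halts b (P.cost.eval n) P s Q

theorem Does.mono (h : Does b n P s Q) (hQ : ∀ s', Q s' → Frame P s s' → Q' s') :
    Does b n P s Q' :=
  Halts.mono h le_rfl hQ

theorem Does.skip (h : Q s) : Does b n .skip s Q :=
  ⟨1, s, .skip s, by simp [Prog.cost], h⟩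

theorem Does.const {x : ℕ} {q : ℚ} (hb : bitLength q ≤ b) (h : Q (s.setReg x q)) :
    Does b n (.const x q) s Q :=
  ⟨1, _, .const x q s hb, by simp [Prog.cost], h⟩

theorem Does.arith {o : Op} {x y z : ℕ} (q : ℚ) (hq : o.eval (s.reg y) (s.reg z) = q)
    (hb : bitLength q ≤ b) (h : Q (s.setReg x q)) : Does b n (.arith o x y z) s Q := by
  subst hq
  exact ⟨1, _, .arith o x y z s hb, by simp [Prog.cost], h⟩

theorem Does.load {x a i : ℕ} (j : ℕ) (q : ℚ) (hj : s.reg i = j) (hq : s.arr a j = q)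
    (hb : bitLength q ≤ b) (h : Q (s.setReg x q)) : Does b n (.load x a i) s Q := by
  subst hq
  obtain rfl : ⌊s.reg i⌋₊ = j := by rw [hj, Nat.floor_natCast]
  exact ⟨1, _, .load x a i s hb, by simp [Prog.cost], h⟩

theorem Does.store {a i x : ℕ} (j : ℕ) (q : ℚ) (hj : s.reg i = j) (hq : s.reg x = q)
    (hb : bitLength q ≤ b) (h : Q (s.setArr a j q)) : Does b n (.store a i x) s Q := by
  subst hq
  obtain rfl : ⌊s.reg i⌋₊ = j := by rw [hj, Nat.floor_natCast]
  exact ⟨1, _, .store a i x s hb, by simp [Prog.cost], h⟩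

theorem Does.seq (h : Does b n P s fun s' => Does b n P' s' Q) : Does b n (.seq P P') s Q := by
  simpa only [Does, Prog.cost, Polynomial.eval_add] using Halts.seq h

theorem Does.bind (h : Does b n P s Q) (h' : ∀ s', Q s' → Frame P s s' → Does b n P' s' Q') :
    Does b n (.seq P P') s Q' :=
  .seq (h.mono h')

theorem Does.ite {x y : ℕ} (ht : s.reg x < s.reg y → Does b n P s Q)
    (hf : ¬ s.reg x < s.reg y → Does b n P' s Q) : Does b n (.ite x y P P') s Q := by
  by_cases h : s.reg x < s.reg y
  · obtain ⟨t, s', hrun, hle, hq⟩ := ht h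
    exact ⟨t + 1, s', hrun.ite_true h, by simp [Prog.cost]; omega, hq⟩
  · obtain ⟨t, s', hrun, hle, hq⟩ := hf h
    exact ⟨t + 1, s', hrun.ite_false h, by simp [Prog.cost]; omega, hq⟩

/-- `for i = 0, …, n - 1 do P`, on states in which register `0` holds `n` and register `2` holds
the number one. -/
def Prog.forAll (i : ℕ) (P : Prog) : Prog :=
  .seq (.const i 0) (.count i 0 P)

theorem Does.forAll {i : ℕ} (Inv : ℕ → State → Prop)
    (hst : P.writesReg i = false ∧ P.writesReg 0 = false ∧ P.writesReg 2 = false ∧ 0 ≠ i ∧ 2 ≠ i)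
    (hbit : ∀ j ≤ n, bitLength (j : ℚ) ≤ b) (hn : s.reg 0 = n) (hone : s.reg 2 = 1)
    (hirr : ∀ j s q, Inv j s → Inv j (s.setReg i q)) (h0 : Inv 0 s)
    (hstep : ∀ j < n, ∀ s', Inv j s' → s'.reg i = j → Frame (.forAll i P) s s' →
      Does b n P s' (Inv (j + 1))) :
    Does b n (.forAll i P) s (Inv n) := by
  obtain ⟨hwi, hw0, hw2, hi0, hi2⟩ := hst
  refine .seq (.const (by simpa using hbit 0 n.zero_le) ?_)
  have frameOf {s'} (hf : Frame (.count i 0 P) (s.setReg i 0) s') : Frame (.forAll i P) s s' := by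
    refine ⟨fun {r} hr => ?_, fun {a} ha => ?_⟩
    · simp only [Prog.forAll, Prog.writesReg, Bool.or_eq_false_iff, beq_eq_false_iff_ne] at hr
      rw [hf.reg hr.2, State.reg_setReg, if_neg hr.1]
    · simp only [Prog.forAll, Prog.writesArr, Bool.or_eq_false_iff] at ha
      rw [hf.arr ha.2, State.arr_setReg]
  refine (Halts.count (T := P.cost.eval n) Inv hwi hw0 hw2 hi0 hi2 hbit
    (by simpa [hi0] using hn) (by simpa [hi2] using hone) (by simp) (hirr) (hirr _ _ _ h0)
    fun j hj s' h hi hf => hstep j hj s' h hi (frameOf hf)).mono ?_ fun s' h _ => h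
  simp only [Prog.count, Prog.cost, Polynomial.eval_add, Polynomial.eval_mul, Polynomial.eval_X,
    Polynomial.eval_one, add_assoc]
  exact le_rfl

end Machine

section BitLength

theorem bitLength_div_le {N D : ℤ} (hD : D ≠ 0) {m : ℕ} (hN : N.natAbs < 2 ^ m)
    (hD' : D.natAbs < 2 ^ m) : bitLength ((N : ℚ) / D) ≤ 2 * m := by
  rw [← Rat.divInt_eq_div]
  have hden : (Rat.divInt N D).den ≤ D.natAbs :=
    Nat.le_of_dvd (Int.natAbs_pos.2 hD) (Int.natCast_dvd.1 (Rat.den_dvd N D))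
  have hnum : (Rat.divInt N D).num.natAbs ≤ N.natAbs := by
    rcases eq_or_ne N 0 with rfl | hN0
    · simp
    · exact Nat.le_of_dvd (Int.natAbs_pos.2 hN0) (Int.natAbs_dvd_natAbs.2 (Rat.num_dvd N hD))
  have := Nat.size_le.2 (hnum.trans_lt hN)
  have := Nat.size_le.2 (hden.trans_lt hD')
  unfold bitLength
  omega

theorem bitLength_natCast_le {m N : ℕ} (h : m ≤ N) : bitLength (m : ℚ) ≤ N + 1 := by
  have : m.size ≤ N := Nat.size_le.2 (h.trans_lt Nat.lt_two_pow_self)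
  simpa [bitLength] using this

end BitLength

/-! ### Computation of an elimination order

Registers `2` and `3` hold the constants one and zero, register `10` receives the outcome of a
test, and register `11` is scratch space. Array `0` is the adjacency matrix, array `1` marks the
vertices that are already eliminated, and array `2` receives the order. -/

section Tests

/-- If the test `T` succeeds then `P`. -/
def Prog.guard (T P : Prog) : Prog :=
  .seq T (.ite 3 10 P .skip)

/-- The test that succeeds if `T` fails. -/
def Prog.negate (T : Prog) : Prog :=
  .seq T (.arith .sub 10 2 10)

/-- The test whether registers `x` and `y` differ. -/
def Prog.distinct (x y : ℕ) : Prog :=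
  .ite x y (.const 10 1) (.ite y x (.const 10 1) (.const 10 0))

/-- The test whether the vertices in registers `x` and `y` are adjacent. -/
def Prog.adj (x y : ℕ) : Prog :=
  .seq (.arith .mul 11 0 x) (.seq (.arith .add 11 11 y) (.load 10 0 11))

/-- The test whether the vertex in register `x` is not yet eliminated. -/
def Prog.alive (x : ℕ) : Prog :=
  .negate (.load 10 1 x)

variable {b n : ℕ} {T P : Prog} {s : State} {p : Prop}

open Classical in
/-- The test `T`, started in `s`, has the truth value of `p` as its outcome. -/
def Decides (b n : ℕ) (T : Prog) (s : State) (p : Prop) : Prop :=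
  Does b n T s fun s' => s'.reg 10 = if p then 1 else 0

/-- The register `r` has been changed to a value with the property `A`, unless there is none. This
describes the combined effect of guarded assignments to `r`. -/
def Chooses (r : ℕ) (A : ℚ → Prop) (s s' : State) : Prop :=
  A (s'.reg r) ∨ (∀ q, ¬ A q) ∧ s'.reg r = s.reg r

theorem Does.guard {Q : State → Prop} (hzero : s.reg 3 = 0) (hw : T.writesReg 3 = false)
    (hT : Decides b n T s p) (hP : p → ∀ s', Frame T s s' → Does b n P s' Q)
    (hQ : ¬ p → ∀ s', Frame T s s' → Q s') : Does b n (.guard T P) s Q := by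
  refine .bind hT fun s₁ h₁ f₁ => ?_
  rw [← f₁.reg hw] at hzero
  by_cases hp : p
  · refine .ite (fun _ => hP hp s₁ f₁) fun h => absurd ?_ h
    rw [hzero, h₁, if_pos hp]
    exact one_pos
  · refine .ite (fun h => absurd h ?_) fun _ => .skip (hQ hp s₁ f₁)
    rw [hzero, h₁, if_neg hp]
    exact lt_irrefl 0

theorem Does.guard_chooses {r : ℕ} {A : ℚ → Prop} (hzero : s.reg 3 = 0)
    (hw : T.writesReg 3 = false ∧ T.writesReg r = false) (hT : Decides b n T s p)
    (hP : p → ∀ s', Frame T s s' → Does b n P s' (Chooses r A s')) :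
    Does b n (.guard T P) s (Chooses r (fun q => p ∧ A q) s) := by
  refine .guard hzero hw.1 hT (fun hp s₁ f₁ => (hP hp s₁ f₁).mono fun s₂ h₂ _ => ?_)
    fun hp s₁ f₁ => .inr ⟨fun _ h => hp h.1, f₁.reg hw.2⟩
  simpa only [Chooses, hp, true_and, f₁.reg hw.2] using h₂

theorem Chooses.trans {r : ℕ} {A B : ℚ → Prop} {s' s'' : State} (h : Chooses r A s s')
    (h' : Chooses r B s' s'') : Chooses r (fun q => A q ∨ B q) s s'' := by
  rcases h' with h' | ⟨hB, h'⟩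
  · exact .inl (.inr h')
  · rw [Chooses, ← h'] at h
    exact h.imp .inl fun ⟨hA, h⟩ => ⟨fun q hq => hq.elim (hA q) (hB q), h⟩

theorem Does.forAll_chooses {i r : ℕ} {A : Fin n → ℚ → Prop}
    (hst : P.writesReg i = false ∧ P.writesReg 0 = false ∧ P.writesReg 2 = false ∧ 0 ≠ i ∧ 2 ≠ i)
    (hr : r ≠ i) (hbit : ∀ j ≤ n, bitLength (j : ℚ) ≤ b) (hn : s.reg 0 = n) (hone : s.reg 2 = 1)
    (hstep : ∀ (v : Fin n) (s' : State), s'.reg i = (v : ℕ) → Frame (.forAll i P) s s' →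
      Does b n P s' (Chooses r (A v) s')) :
    Does b n (.forAll i P) s (Chooses r (fun q => ∃ v, A v q) s) := by
  refine (Does.forAll (fun j => Chooses r (fun q => ∃ v : Fin n, (v : ℕ) < j ∧ A v q) s) hst hbit
    hn hone (fun j s' q h => by simpa [Chooses, hr] using h) (.inr ⟨by simp, rfl⟩)
    fun j hj s₁ h₁ hj₁ f₁ => ?_).mono fun s' h' _ => by simpa using h'
  refine (hstep ⟨j, hj⟩ s₁ hj₁ f₁).mono fun s₂ h₂ _ => ?_
  convert h₁.trans h₂ using 3 with q
  simp only [Order.lt_add_one_iff, le_iff_eq_or_lt, or_and_right, exists_or]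
  rw [or_comm]
  exact or_congr_right ⟨fun ⟨v, hv, h⟩ => Fin.ext (a := v) (b := ⟨j, hj⟩) hv ▸ h,
    fun h => ⟨_, rfl, h⟩⟩

theorem Decides.negate (hone : s.reg 2 = 1) (hw : T.writesReg 2 = false) (h0 : bitLength 0 ≤ b)
    (h1 : bitLength 1 ≤ b) (hT : Decides b n T s p) : Decides b n (.negate T) s (¬ p) := by
  refine .bind hT fun s₁ h₁ f₁ => ?_
  have hone₁ : s₁.reg 2 = 1 := (f₁.reg hw).trans hone
  by_cases hp : p
  · exact .arith 0 (by simp [Op.eval, h₁, hp, hone₁]) h0 (by simp [hp])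
  · exact .arith 1 (by simp [Op.eval, h₁, hp, hone₁]) h1 (by simp [hp])

theorem decides_distinct {x y : ℕ} (h0 : bitLength 0 ≤ b) (h1 : bitLength 1 ≤ b) :
    Decides b n (.distinct x y) s (s.reg x ≠ s.reg y) := by
  refine .ite (fun h => .const h1 (by simp [h.ne])) fun h => .ite (fun h' => ?_) fun h' => ?_
  · exact .const h1 (by simp [h'.ne'])
  · exact .const h0 (by simp [le_antisymm (not_lt.1 h') (not_lt.1 h)])

end Tests

section OrderProgram

/-- Set register `8` to zero if the vertices in registers `6` and `7` show that the vertex in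
register `5` is not simplicial. -/
def Prog.checkPair : Prog :=
  .guard (.distinct 6 7) <| .guard (.alive 6) <| .guard (.alive 7) <| .guard (.adj 5 6) <|
    .guard (.adj 5 7) <| .guard (.negate (.adj 6 7)) <| .const 8 0

/-- The test whether the vertex in register `5` is simplicial among the vertices that are left. -/
def Prog.checkSimplicial : Prog :=
  .seq (.const 8 1) (.seq (.forAll 6 (.forAll 7 .checkPair)) (.arith .add 10 8 3))

/-- Put into register `9` a simplicial vertex among the vertices that are left. -/
def Prog.findSimplicial : Prog :=
  .forAll 5 (.guard (.alive 5) (.guard .checkSimplicial (.arith .add 9 5 3)))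

/-- Compute an elimination order. -/
def Prog.findOrder : Prog :=
  .forAll 4 (.seq .findSimplicial (.seq (.store 2 4 9) (.store 1 9 2)))

variable {n b : ℕ} {G : SimpleGraph (Fin n)} {s : State} {D L : List (Fin n)}

/-- The constants that the program uses, and all indices of entries of the adjacency matrix, may
be written. -/
def IndicesFit (n b : ℕ) : Prop := ∀ m : ℕ, m ≤ n * n + 1 → bitLength (m : ℚ) ≤ b

theorem IndicesFit.zero (h : IndicesFit n b) : bitLength 0 ≤ b := by simpa using h 0 (by omega)

theorem IndicesFit.one (h : IndicesFit n b) : bitLength 1 ≤ b := by simpa using h 1 (by omega)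

theorem IndicesFit.le (h : IndicesFit n b) (j : ℕ) (hj : j ≤ n) : bitLength (j : ℚ) ≤ b :=
  h j (by nlinarith)

theorem IndicesFit.bit (h : IndicesFit n b) (p : Prop) [Decidable p] :
    bitLength (if p then 1 else 0) ≤ b := by
  split_ifs
  exacts [h.one, h.zero]

open Classical in
/-- The memory holds the graph `G` and the constants. -/
structure HoldsGraph (G : SimpleGraph (Fin n)) (s : State) : Prop where
  size : s.reg 0 = n
  one : s.reg 2 = 1
  zero : s.reg 3 = 0
  adj : ∀ u v : Fin n, s.arr 0 (n * (u : ℕ) + (v : ℕ)) = if G.Adj u v then 1 else 0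

theorem HoldsGraph.frame {P : Prog} {s' : State} (h : HoldsGraph G s) (hf : Frame P s s')
    (hP : P.writesReg 0 = false ∧ P.writesReg 2 = false ∧ P.writesReg 3 = false ∧
      P.writesArr 0 = false) : HoldsGraph G s' :=
  ⟨(hf.reg hP.1).trans h.size, (hf.reg hP.2.1).trans h.one, (hf.reg hP.2.2.1).trans h.zero,
    by rw [hf.arr hP.2.2.2]; exact h.adj⟩

theorem HoldsGraph.decides_adj (hs : HoldsGraph G s) (hb : IndicesFit n b) {x y : ℕ} (u v : Fin n)
    (hu : s.reg x = (u : ℕ)) (hv : s.reg y = (v : ℕ)) (hy : y ≠ 11) :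
    Decides b n (.adj x y) s (G.Adj u v) := by
  have hle : n * (u : ℕ) + v ≤ n * n := by nlinarith [u.2, v.2]
  refine .seq (.arith ((n * (u : ℕ) : ℕ) : ℚ) (by simp [Op.eval, hs.size, hu]) (hb _ (by omega)) ?_)
  refine .seq (.arith ((n * (u : ℕ) + (v : ℕ) : ℕ) : ℚ) (by simp [Op.eval, hv, hy])
    (hb _ (by omega)) ?_)
  classical
  exact .load (n * (u : ℕ) + (v : ℕ)) (if G.Adj u v then 1 else 0) (by simp)
    (by simpa using hs.adj u v) (hb.bit _) (by simp)

open Classical in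
/-- Moreover the vertices in `D` are marked as eliminated. -/
structure HoldsElim (G : SimpleGraph (Fin n)) (D : List (Fin n)) (s : State) : Prop
    extends HoldsGraph G s where
  mark : ∀ v : Fin n, s.arr 1 v = if v ∈ D then 1 else 0

theorem HoldsElim.frame {P : Prog} {s' : State} (h : HoldsElim G D s) (hf : Frame P s s')
    (hP : (P.writesReg 0 = false ∧ P.writesReg 2 = false ∧ P.writesReg 3 = false ∧
      P.writesArr 0 = false) ∧ P.writesArr 1 = false) : HoldsElim G D s' :=
  ⟨h.toHoldsGraph.frame hf hP.1, by rw [hf.arr hP.2]; exact h.mark⟩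

theorem HoldsElim.decides_alive (hs : HoldsElim G D s) (hb : IndicesFit n b) {x : ℕ} (u : Fin n)
    (hu : s.reg x = (u : ℕ)) : Decides b n (.alive x) s (u ∉ D) :=
  .negate hs.one rfl hb.zero hb.one
    (.load u _ hu (hs.mark u) (hb.bit _) (by simp))

/-- Moreover the vertices `v`, `u`, `w` are in registers `5`, `6`, `7`. -/
structure HoldsTriple (G : SimpleGraph (Fin n)) (D : List (Fin n)) (v u w : Fin n) (s : State) :
    Prop extends HoldsElim G D s where
  center : s.reg 5 = (v : ℕ)
  left : s.reg 6 = (u : ℕ)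
  right : s.reg 7 = (w : ℕ)

theorem HoldsTriple.frame {P : Prog} {s' : State} {v u w : Fin n} (h : HoldsTriple G D v u w s)
    (hf : Frame P s s')
    (hP : ((P.writesReg 0 = false ∧ P.writesReg 2 = false ∧ P.writesReg 3 = false ∧
      P.writesArr 0 = false) ∧ P.writesArr 1 = false) ∧
      P.writesReg 5 = false ∧ P.writesReg 6 = false ∧ P.writesReg 7 = false) :
    HoldsTriple G D v u w s' :=
  ⟨h.toHoldsElim.frame hf hP.1, (hf.reg hP.2.1).trans h.center, (hf.reg hP.2.2.1).trans h.left,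
    (hf.reg hP.2.2.2).trans h.right⟩

theorem does_checkPair {v u w : Fin n} (h : HoldsTriple G D v u w s) (hb : IndicesFit n b) :
    Does b n .checkPair s (Chooses 8 (fun q => u ≠ w ∧ u ∉ D ∧ w ∉ D ∧ G.Adj v u ∧ G.Adj v w ∧
      ¬ G.Adj u w ∧ q = 0) s) := by
  have huw : u ≠ w ↔ s.reg 6 ≠ s.reg 7 := by simp [h.left, h.right, Fin.val_inj]
  rw [huw]
  refine .guard_chooses h.zero (by decide) (decides_distinct hb.zero hb.one) fun _ s₁ f => ?_
  replace h := h.frame f (by decide)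
  refine .guard_chooses h.zero (by decide) (h.decides_alive hb u h.left) fun _ s₂ f => ?_
  replace h := h.frame f (by decide)
  refine .guard_chooses h.zero (by decide) (h.decides_alive hb w h.right) fun _ s₃ f => ?_
  replace h := h.frame f (by decide)
  refine .guard_chooses h.zero (by decide) (h.decides_adj hb v u h.center h.left (by decide))
    fun _ s₄ f => ?_
  replace h := h.frame f (by decide)
  refine .guard_chooses h.zero (by decide) (h.decides_adj hb v w h.center h.right (by decide))
    fun _ s₅ f => ?_
  replace h := h.frame f (by decide)
  refine .guard_chooses h.zero (by decide) (.negate h.one (by decide) hb.zero hb.one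
    (h.decides_adj hb u w h.left h.right (by decide))) fun _ _ _ => ?_
  exact .const hb.zero (.inl (by simp))

theorem isSimplicialIn_setOf_notMem {v : Fin n} : IsSimplicialIn G {x | x ∉ D} v ↔
    ∀ u w, ¬ (u ≠ w ∧ u ∉ D ∧ w ∉ D ∧ G.Adj v u ∧ G.Adj v w ∧ ¬ G.Adj u w) := by
  refine ⟨fun h u w ⟨hne, hu, hw, hvu, hvw, hna⟩ => hna (h ⟨hu, hvu⟩ ⟨hw, hvw⟩ hne),
    fun h u hu w hw hne => ?_⟩
  by_contra hna
  exact h u w ⟨hne, hu.1, hw.1, hu.2, hw.2, hna⟩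

theorem decides_checkSimplicial (hs : HoldsElim G D s) (hb : IndicesFit n b) {v : Fin n}
    (hv : s.reg 5 = (v : ℕ)) :
    Decides b n .checkSimplicial s (IsSimplicialIn G {x | x ∉ D} v) := by
  refine .seq (.const hb.one ?_)
  have hs₀ := hs.frame (.setReg s 8 1) (by decide)
  have hpairs : Does b n (.forAll 6 (.forAll 7 .checkPair)) (s.setReg 8 1) (Chooses 8
      (fun q => ∃ u w, u ≠ w ∧ u ∉ D ∧ w ∉ D ∧ G.Adj v u ∧ G.Adj v w ∧ ¬ G.Adj u w ∧ q = 0)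
      (s.setReg 8 1)) := by
    refine .forAll_chooses (by decide) (by decide) hb.le hs₀.size hs₀.one fun u s₁ hu f₁ => ?_
    have hs₁ := hs₀.frame f₁ (by decide)
    refine .forAll_chooses (by decide) (by decide) hb.le hs₁.size hs₁.one fun w s₂ hw f₂ => ?_
    refine does_checkPair ⟨hs₁.frame f₂ (by decide), ?_, (f₂.reg rfl).trans hu, hw⟩ hb
    rw [f₂.reg rfl, f₁.reg rfl, State.reg_setReg, if_neg (by decide), hv]
  refine .bind hpairs fun s₁ h₁ f₁ => ?_
  have hzero : s₁.reg 3 = 0 := (f₁.reg rfl).trans hs₀.zero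
  rw [isSimplicialIn_setOf_notMem]
  rcases h₁ with ⟨u, w, h₁⟩ | ⟨hnone, h₁⟩
  · refine .arith 0 (by simp [Op.eval, h₁, hzero]) hb.zero ?_
    rw [if_neg fun h => h u w (by tauto)]
    simp
  · refine .arith 1 (by simp [Op.eval, h₁, hzero]) hb.one ?_
    rw [if_pos fun u w h => hnone 0 ⟨u, w, by tauto⟩]
    simp

theorem does_findSimplicial (hs : HoldsElim G D s) (hb : IndicesFit n b) :
    Does b n .findSimplicial s (Chooses 9
      (fun q => ∃ v : Fin n, v ∉ D ∧ IsSimplicialIn G {x | x ∉ D} v ∧ q = (v : ℕ)) s) := by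
  refine .forAll_chooses (by decide) (by decide) hb.le hs.size hs.one fun v s₁ hv f => ?_
  replace hs := hs.frame f (by decide)
  refine .guard_chooses hs.zero (by decide) (hs.decides_alive hb v hv) fun _ s₂ f => ?_
  replace hs := hs.frame f (by decide)
  rw [← f.reg (r := 5) rfl] at hv
  refine .guard_chooses hs.zero (by decide) (decides_checkSimplicial hs hb hv) fun _ s₃ f => ?_
  replace hs := hs.frame f (by decide)
  rw [← f.reg (r := 5) rfl] at hv
  exact .arith (v : ℕ) (by simp [Op.eval, hv, hs.zero]) (hb.le _ v.2.le) (.inl (by simp))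

/-- Every elimination order of the other vertices can be continued by `L` at its beginning. -/
def IsElimPrefix (G : SimpleGraph (Fin n)) (L : List (Fin n)) : Prop :=
  L.Nodup ∧ ∀ l, (L ++ l).Nodup → IsElimOrder G l → IsElimOrder G (L ++ l)

theorem IsElimPrefix.isElimOrder (hL : IsElimPrefix G L) : IsElimOrder G L := by
  simpa using hL.2 [] (by simpa using hL.1) trivial

theorem IsElimPrefix.concat (hL : IsElimPrefix G L) {v : Fin n} (hv : v ∉ L)
    (hsimp : IsSimplicialIn G {x | x ∉ L} v) : IsElimPrefix G (L ++ [v]) := by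
  refine ⟨by simpa using hL.1.concat hv, fun l hnd hl => ?_⟩
  rw [List.append_assoc, List.singleton_append] at hnd ⊢
  obtain ⟨-, hvl, hdisj⟩ := List.nodup_append.1 hnd
  refine hL.2 _ hnd ⟨(List.nodup_cons.1 hvl).1, hsimp.mono fun x hx hxL => ?_, hl⟩
  exact hdisj x hxL x (List.mem_cons_of_mem _ hx.1) rfl

theorem IsChordal.exists_isSimplicialIn_setOf_notMem (hG : IsChordal G) (hL : L.length < n) :
    ∃ v, v ∉ L ∧ IsSimplicialIn G {x | x ∉ L} v := by
  have hne : (L.toFinsetᶜ).Nonempty := by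
    rw [← Finset.card_pos, Finset.card_compl, Fintype.card_fin]
    exact Nat.sub_pos_of_lt (L.toFinset_card_le.trans_lt hL)
  obtain ⟨v, hv, hsimp⟩ := hG.exists_isSimplicialIn hne
  exact ⟨v, by simpa using hv, hsimp.mono fun x hx => by simpa using hx.1⟩

/-- Array `2` begins with the list `L` of vertices. -/
def HoldsList (L : List (Fin n)) (s : State) : Prop :=
  ∀ (i : ℕ) (hi : i < L.length), s.arr 2 i = ((L[i] : Fin n) : ℕ)

theorem HoldsList.concat (h : HoldsList L s) (v : Fin n) :
    HoldsList (L ++ [v]) (s.setArr 2 L.length (v : ℕ)) := by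
  intro i hi
  rw [State.arr_setArr]
  rcases (Nat.lt_succ_iff_lt_or_eq.1 (by simpa using hi : i < L.length + 1)) with hi' | rfl
  · simp [hi'.ne, h i hi', List.getElem_append_left hi']
  · simp

theorem does_findOrder (hG : IsChordal G) (hs : HoldsElim G [] s) (hb : IndicesFit n b) :
    Does b n .findOrder s fun s' =>
      ∃ L : List (Fin n), L.length = n ∧ IsElimOrder G L ∧ HoldsList L s' := by
  refine (Does.forAll (fun j s' => ∃ L : List (Fin n), L.length = j ∧ IsElimPrefix G L ∧
      HoldsElim G L s' ∧ HoldsList L s') (by decide) hb.le hs.size hs.one ?_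
    ⟨[], rfl, ⟨by simp, by simp⟩, hs, by simp [HoldsList]⟩ fun j hj s₁ h₁ hj₁ _ => ?_).mono
    fun s' h' _ => ?_
  · rintro j s' q ⟨L, hL, hpre, hs', hlist⟩
    exact ⟨L, hL, hpre, hs'.frame (.setReg s' 4 q) (by decide), hlist⟩
  · obtain ⟨L, rfl, hpre, hs₁, hlist⟩ := h₁
    refine .bind (does_findSimplicial hs₁ hb) fun s₂ h₂ f₂ => ?_
    obtain ⟨v, hvL, hsimp, hv⟩ : ∃ v : Fin n, v ∉ L ∧ IsSimplicialIn G {x | x ∉ L} v ∧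
        s₂.reg 9 = (v : ℕ) := by
      obtain ⟨v, hv⟩ := hG.exists_isSimplicialIn_setOf_notMem hj
      exact h₂.resolve_right fun h => h.1 _ ⟨v, hv.1, hv.2, rfl⟩
    have hs₂ := hs₁.frame f₂ (by decide)
    refine .seq (.store L.length v ((f₂.reg rfl).trans hj₁) hv (hb.le v v.2.le) ?_)
    refine .store v 1 hv hs₂.one hb.one ⟨L ++ [v], by simp, hpre.concat hvL hsimp,
      ⟨⟨hs₂.size, hs₂.one, hs₂.zero, ?_⟩, fun x => ?_⟩, ?_⟩
    · simpa using hs₂.adj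
    · by_cases hx : x = v <;> simp [State.arr_setArr, hs₂.mark, Fin.val_inj, hx]
    · have hlist₂ : HoldsList L s₂ := fun i hi => (congrFun (f₂.arr rfl) i).trans (hlist i hi)
      simpa [HoldsList] using hlist₂.concat v
  · obtain ⟨L, hL, hpre, -, hlist⟩ := h'
    exact ⟨L, hL, hpre.isElimOrder, hlist⟩

end OrderProgram

/-! ### The test for feasibility

Array `3` holds the current weights of the vertices, in the order of elimination. -/

section TestProgram

/-- The test whether the vertex in register `5` is adjacent to the vertex at position `6`. -/
def Prog.adjacentAt : Prog :=
  .seq (.load 7 2 6) (.adj 5 7)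

/-- Divide the weight at position `6` by register `19`. -/
def Prog.divideWeight : Prog :=
  .seq (.load 18 3 6) (.seq (.arith .div 18 18 19) (.store 3 6 18))

/-- Update the weight at position `6` for the elimination of the vertex in register `5`, whose
position is in register `4`. Register `19` holds the divisor. -/
def Prog.updateWeight : Prog :=
  .ite 4 6 (.guard .adjacentAt .divideWeight) .skip

/-- Eliminate the vertex at position `4`, or set register `17` to one if its weight is too large. -/
def Prog.eliminate : Prog :=
  .seq (.load 18 3 4) (.ite 18 2
    (.seq (.arith .sub 19 2 18) (.seq (.load 5 2 4) (.forAll 6 .updateWeight)))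
    (.const 17 1))

/-- The test whether the constant weight `1 / y` is not feasible, where `y` is in register `15`. -/
def Prog.infeasible : Prog :=
  .seq (.arith .div 16 2 15) (.seq (.const 17 0) (.seq (.forAll 6 (.store 3 6 16))
    (.seq (.forAll 4 (.ite 17 2 .eliminate .skip)) (.arith .add 10 17 3))))

variable {n b : ℕ} {G : SimpleGraph (Fin n)} {s : State} {L : List (Fin n)} {x : ℚ} {i j : ℕ}

/-- The weights after the elimination of the first `j` vertices of `L` at the constant weight
`x`. -/
noncomputable def weightAt (G : SimpleGraph (Fin n)) (L : List (Fin n)) (x : ℚ) (j : ℕ) :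
    Fin n → ℚ :=
  weightAfter G (L.take j) fun _ => x

theorem weightAt_succ (hj : j < L.length) :
    weightAt G L x (j + 1) = reweight G L[j] (weightAt G L x j) := by
  rw [weightAt, List.take_succ_eq_append_getElem hj, weightAfter_append]
  rfl

theorem feasible_take_succ (hj : j < L.length) :
    Feasible G (L.take (j + 1)) (fun _ => x) ↔
      Feasible G (L.take j) (fun _ => x) ∧ weightAt G L x j L[j] < 1 := by
  rw [List.take_succ_eq_append_getElem hj, feasible_append]
  simp [Feasible, weightAt]

theorem Feasible.take (h : Feasible G L fun _ => x) (j : ℕ) :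
    Feasible G (L.take j) fun _ => x := by
  rw [← List.take_append_drop j L, feasible_append] at h
  exact h.1

/-- The numbers that occur in the elimination at the constant weight `x` may be written. -/
structure WeightsFit (G : SimpleGraph (Fin n)) (L : List (Fin n)) (x : ℚ) (b : ℕ) : Prop where
  start : bitLength x ≤ b
  weight : ∀ (j i : ℕ) (hi : i < L.length), j ≤ i → Feasible G (L.take j) (fun _ => x) →
    bitLength (weightAt G L x j L[i]) ≤ b
  divisor : ∀ (j i : ℕ) (hi : i < L.length), j ≤ i → Feasible G (L.take j) (fun _ => x) →
    bitLength (1 - weightAt G L x j L[i]) ≤ b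

/-- The memory holds the graph `G` and the list `L`. -/
structure HoldsOrder (G : SimpleGraph (Fin n)) (L : List (Fin n)) (s : State) : Prop
    extends HoldsGraph G s where
  order : HoldsList L s

theorem HoldsOrder.frame {P : Prog} {s' : State} (h : HoldsOrder G L s) (hf : Frame P s s')
    (hP : (P.writesReg 0 = false ∧ P.writesReg 2 = false ∧ P.writesReg 3 = false ∧
      P.writesArr 0 = false) ∧ P.writesArr 2 = false) : HoldsOrder G L s' :=
  ⟨h.toHoldsGraph.frame hf hP.1, fun i hi => (congrFun (hf.arr hP.2) i).trans (h.order i hi)⟩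

theorem HoldsOrder.decides_adjacentAt (hs : HoldsOrder G L s) (hb : IndicesFit n b) {v : Fin n}
    (hi : i < L.length) (h5 : s.reg 5 = (v : ℕ)) (h6 : s.reg 6 = i) :
    Decides b n .adjacentAt s (G.Adj v L[i]) :=
  .seq (.load i _ h6 (hs.order i hi) (hb.le _ (L[i]).2.le)
    ((hs.frame (.setReg s 7 _) (by decide)).decides_adj hb v L[i] (by simpa using h5) (by simp)
      (by decide)))

/-- Moreover the vertex at position `j` is being eliminated. -/
structure HoldsStep (G : SimpleGraph (Fin n)) (L : List (Fin n)) (x : ℚ) (j : ℕ)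
    (hj : j < L.length) (s : State) : Prop extends HoldsOrder G L s where
  position : s.reg 4 = j
  vertex : s.reg 5 = ((L[j] : Fin n) : ℕ)
  divisor : s.reg 19 = 1 - weightAt G L x j L[j]

theorem does_updateWeight {hj : j < L.length} (hs : HoldsStep G L x j hj s) (hb : IndicesFit n b)
    (hx : WeightsFit G L x b) (hf : Feasible G (L.take (j + 1)) fun _ => x) (hi : i < L.length)
    (h6 : s.reg 6 = i) (h3 : j < i → s.arr 3 i = weightAt G L x j L[i]) :
    Does b n .updateWeight s fun s' => s'.arr 3 =
      if j < i then Function.update (s.arr 3) i (weightAt G L x (j + 1) L[i]) else s.arr 3 := by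
  have hcmp : s.reg 4 < s.reg 6 ↔ j < i := by rw [hs.position, h6, Nat.cast_lt]
  refine .ite (fun hlt => ?_) fun hle => .skip (by rw [if_neg (mt hcmp.2 hle)])
  have hji := hcmp.1 hlt
  simp only [if_pos hji]
  have hsucc : weightAt G L x (j + 1) L[i] = reweight G L[j] (weightAt G L x j) L[i] := by
    rw [weightAt_succ hj]
  refine .guard hs.zero (by decide) (hs.decides_adjacentAt hb hi hs.vertex h6) (fun hadj s₁ f => ?_)
    fun hadj s₁ f => ?_
  · rw [reweight, if_pos hadj] at hsucc
    have h6' : s₁.reg 6 = i := (f.reg rfl).trans h6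
    refine .seq (.load i (weightAt G L x j L[i]) h6' (by rw [f.arr rfl, h3 hji])
      (hx.weight j i hi hji.le ((feasible_take_succ hj).1 hf).1) ?_)
    refine .seq (.arith (weightAt G L x (j + 1) L[i])
      (by simp [Op.eval, f.reg (r := 19) rfl, hs.divisor, hsucc])
      (hx.weight (j + 1) i hi hji hf) ?_)
    refine .store i (weightAt G L x (j + 1) L[i]) (by simpa using h6') (by simp)
      (hx.weight (j + 1) i hi hji hf) ?_
    simp [State.setArr, f.arr (a := 3) rfl]
  · rw [reweight, if_neg hadj, ← h3 hji] at hsucc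
    rw [hsucc, Function.update_eq_self, f.arr rfl]

/-- Array `3` holds the weights `w` of the vertices of `L` from position `j` on. -/
def HoldsWeights (w : Fin n → ℚ) (L : List (Fin n)) (j : ℕ) (s : State) : Prop :=
  ∀ (i : ℕ) (hi : i < L.length), j ≤ i → s.arr 3 i = w L[i]

theorem does_forAll_updateWeight (hj : j < L.length) (hs : HoldsStep G L x j hj s)
    (hb : IndicesFit n b) (hx : WeightsFit G L x b) (hL : L.length = n)
    (hf : Feasible G (L.take (j + 1)) fun _ => x) (h3 : HoldsWeights (weightAt G L x j) L j s) :
    Does b n (.forAll 6 .updateWeight) s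
      (HoldsWeights (weightAt G L x (j + 1)) L (j + 1)) := by
  refine (Does.forAll (fun m s' => ∀ (i : ℕ) (hi : i < L.length), j < i →
      s'.arr 3 i = weightAt G L x (if i < m then j + 1 else j) L[i])
    (by decide) hb.le hs.size hs.one (fun j s q h => by simpa using h)
    (fun i hi hji => by simpa using h3 i hi hji.le)
    fun m hm s₁ h₁ hm₁ f => ?_).mono fun s₁ h₁ _ i hi hji => ?_
  · have hs₁ : HoldsStep G L x j hj s₁ := ⟨hs.toHoldsOrder.frame f (by decide),
      (f.reg rfl).trans hs.position, (f.reg rfl).trans hs.vertex, (f.reg rfl).trans hs.divisor⟩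
    have hmL : m < L.length := hm.trans_eq hL.symm
    refine (does_updateWeight hs₁ hb hx hf hmL hm₁ fun hjm => by simpa using h₁ m hmL hjm).mono
      fun s₂ h₂ _ i hi hji => ?_
    rcases eq_or_ne i m with rfl | him
    · simp [h₂, hji]
    · have : i < m + 1 ↔ i < m := by omega
      split_ifs at h₂ <;> simp [h₂, him, this, h₁ i hi hji]
  · rw [h₁ i hi hji, if_pos (hi.trans_eq hL)]

/-- The state of the test after `j` rounds: either no weight was too large, or register `17` holds
one. -/
def TestedUpTo (G : SimpleGraph (Fin n)) (L : List (Fin n)) (x : ℚ) (j : ℕ) (s : State) : Prop :=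
  (s.reg 17 = 0 ∧ Feasible G (L.take j) (fun _ => x) ∧ HoldsWeights (weightAt G L x j) L j s) ∨
    (s.reg 17 = 1 ∧ ¬ Feasible G L fun _ => x)

theorem does_eliminate (hs : HoldsOrder G L s) (hb : IndicesFit n b) (hx : WeightsFit G L x b)
    (hL : L.length = n) (hj : j < L.length) (hf : Feasible G (L.take j) fun _ => x)
    (h4 : s.reg 4 = j) (h17 : s.reg 17 = 0) (h3 : HoldsWeights (weightAt G L x j) L j s) :
    Does b n .eliminate s (TestedUpTo G L x (j + 1)) := by
  refine .seq (.load j _ h4 (h3 j hj le_rfl) (hx.weight j j hj le_rfl hf) ?_)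
  refine .ite (fun h => ?_) fun h => .const hb.one (.inr ⟨by simp, fun hc => h ?_⟩)
  · have hlt : weightAt G L x j L[j] < 1 := by simpa [hs.one] using h
    have hf' := (feasible_take_succ hj).2 ⟨hf, hlt⟩
    refine .seq (.arith (1 - weightAt G L x j L[j]) (by simp [Op.eval, hs.one])
      (hx.divisor j j hj le_rfl hf) ?_)
    refine .seq (.load j _ (by simpa using h4) (hs.order j hj) (hb.le _ (L[j]).2.le) ?_)
    have hs₁ := ((hs.frame (.setReg s 18 (weightAt G L x j L[j])) (by decide)).frame
      (.setReg _ 19 (1 - weightAt G L x j L[j])) (by decide)).frame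
      (.setReg _ 5 ((L[j] : Fin n) : ℕ)) (by decide)
    exact (does_forAll_updateWeight hj ⟨hs₁, by simpa using h4, by simp, by simp⟩ hb hx hL hf'
      h3).mono fun s₂ h₂ f => .inl ⟨(f.reg rfl).trans (by simpa using h17), hf', h₂⟩
  · simpa [hs.one] using ((feasible_take_succ hj).1 (hc.take (j + 1))).2

theorem does_fillWeights (hs : HoldsOrder G L s) (hb : IndicesFit n b) (hx : bitLength x ≤ b)
    (hL : L.length = n) (h16 : s.reg 16 = x) :
    Does b n (.forAll 6 (.store 3 6 16)) s (HoldsWeights (fun _ => x) L 0) := by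
  refine (Does.forAll (fun m s' => ∀ i < m, s'.arr 3 i = x) (by decide) hb.le hs.size hs.one
    (fun j s q h => by simpa using h) (by simp) fun m hm s₁ h₁ hm₁ f => ?_).mono
    fun s₁ h₁ _ i hi _ => h₁ i (hi.trans_eq hL)
  refine .store m x hm₁ ((f.reg rfl).trans h16) hx fun i hi => ?_
  rcases Nat.lt_succ_iff_lt_or_eq.1 hi with hi | rfl
  · simpa [State.arr_setArr, hi.ne] using h₁ i hi
  · simp [State.arr_setArr]

theorem does_eliminateAll (hs : HoldsOrder G L s) (hb : IndicesFit n b) (hx : WeightsFit G L x b)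
    (hL : L.length = n) (h17 : s.reg 17 = 0) (h3 : HoldsWeights (fun _ => x) L 0 s) :
    Does b n (.forAll 4 (.ite 17 2 .eliminate .skip)) s (TestedUpTo G L x n) := by
  refine .forAll (TestedUpTo G L x) (by decide) hb.le hs.size hs.one
    (fun j s q h => by simpa [TestedUpTo, HoldsWeights] using h)
    (.inl ⟨h17, trivial, h3⟩) fun j hj s₁ h₁ hj₁ f => ?_
  have hs₁ := hs.frame f (by decide)
  rcases h₁ with ⟨h17, hf, h3⟩ | ⟨h17, hf⟩
  · refine .ite (fun _ => ?_) fun h => absurd ?_ h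
    · exact does_eliminate hs₁ hb hx hL (hj.trans_eq hL.symm) hf hj₁ h17 h3
    · rw [h17, hs₁.one]
      exact one_pos
  · refine .ite (fun h => absurd h ?_) fun _ => .skip (.inr ⟨h17, hf⟩)
    rw [h17, hs₁.one]
    exact lt_irrefl 1

theorem decides_infeasible {y : ℚ} (hs : HoldsOrder G L s) (hb : IndicesFit n b)
    (hx : WeightsFit G L y⁻¹ b) (hL : L.length = n) (h15 : s.reg 15 = y) :
    Decides b n .infeasible s (¬ Feasible G L fun _ => y⁻¹) := by
  refine .seq (.arith y⁻¹ (by simp [Op.eval, hs.one, h15]) hx.start ?_)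
  refine .seq (.const hb.zero ?_)
  have hs₁ := (hs.frame (.setReg s 16 y⁻¹) (by decide)).frame (.setReg _ 17 0) (by decide)
  refine .bind (does_fillWeights hs₁ hb hx.start hL (by simp)) fun s₂ h₂ f₂ => ?_
  have hs₂ := hs₁.frame f₂ (by decide)
  refine .bind (does_eliminateAll hs₂ hb hx hL ((f₂.reg rfl).trans (by simp)) h₂)
    fun s₃ h₃ f₃ => ?_
  have hzero : s₃.reg 3 = 0 := (f₃.reg rfl).trans hs₂.zero
  rw [TestedUpTo, List.take_of_length_le hL.le] at h₃
  rcases h₃ with ⟨h17, hf, -⟩ | ⟨h17, hf⟩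
  · exact .arith 0 (by simp [Op.eval, h17, hzero]) hb.zero (by simp [hf])
  · exact .arith 1 (by simp [Op.eval, h17, hzero]) hb.one (by simp [hf])

end TestProgram

/-! ### The size of the numbers -/

section Size

variable {n b k : ℕ} {G : SimpleGraph (Fin n)} {L : List (Fin n)} {a c e i j : ℕ}

theorem IsElimOrder.exists_int_one_sub_weightAt (hl : IsElimOrder G L) (hc : c ≠ 0)
    (hi : i < L.length) (hji : j ≤ i) (hf : Feasible G (L.take j) fun _ => (a : ℚ) / c) :
    ∃ N D : ℤ, D ≠ 0 ∧ |N| ≤ ((a + c : ℕ) : ℤ) ^ (j + 1) ∧ |D| ≤ ((a + c : ℕ) : ℤ) ^ (j + 1) ∧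
      1 - weightAt G L ((a : ℚ) / c) j L[i] = N / D := by
  have hsub : (L.take j ++ [L[i]]).Sublist L := by
    have hi' : L[i] ∈ L.drop j := List.mem_drop_iff_getElem.2 ⟨i - j, by omega, by congr 1; omega⟩
    have := (List.Sublist.refl (L.take j)).append (List.singleton_sublist.2 hi')
    rwa [List.take_append_drop] at this
  have hl₀ := hl.sublist (L.take_sublist j)
  have hl₁ := hl.sublist hsub
  have hcard₀ : (L.take j).toFinset.card = j := by
    rw [List.toFinset_card_of_nodup hl₀.nodup, List.length_take]
    omega
  have hcard₁ : (L.take j ++ [L[i]]).toFinset.card = j + 1 := by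
    rw [List.toFinset_card_of_nodup hl₁.nodup, List.length_append, List.length_take,
      List.length_singleton]
    omega
  obtain ⟨M, hM, hM'⟩ := exists_int_indepValue G (L.take j).toFinset (a := a) hc
  obtain ⟨N, hN, hN'⟩ := exists_int_indepValue G (L.take j ++ [L[i]]).toFinset (a := a) hc
  rw [hcard₀] at hM hM'
  rw [hcard₁] at hN hN'
  have hcq : (c : ℚ) ≠ 0 := Nat.cast_ne_zero.2 hc
  have hpos := (hl₀.indepValue_pos hf).ne'
  have hM0 : (M : ℚ) ≠ 0 := hM ▸ mul_ne_zero hpos (pow_ne_zero j hcq)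
  refine ⟨N, c * M, mul_ne_zero (Nat.cast_ne_zero.2 hc) (Int.cast_ne_zero.1 hM0), hN', ?_, ?_⟩
  · rw [abs_mul, pow_succ', Nat.abs_cast]
    gcongr
    exact c.le_add_left a
  · rw [Int.cast_mul, Int.cast_natCast, ← hM, ← hN, hl₁.indepValue_concat hf, weightAt]
    field_simp
    ring

theorem bitLength_natCast_div_natCast_le (hc : c ≠ 0) (ha : a < 2 ^ e) (hc' : c < 2 ^ e) :
    bitLength ((a : ℚ) / c) ≤ 2 * e := by
  simpa using bitLength_div_le (N := a) (D := c) (Nat.cast_ne_zero.2 hc) ha hc'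

theorem IsElimOrder.weightsFit (hl : IsElimOrder G L) (hL : L.length = n) (hc : c ≠ 0)
    (ha : a < 2 ^ e) (hc' : c < 2 ^ e) (he : 2 * e ≤ b) (hb : 2 * ((e + 1) * n + 2) ≤ b) :
    WeightsFit G L ((a : ℚ) / c) b := by
  have hpow {j i : ℕ} (hi : i < L.length) (hji : j ≤ i) :
      ((a + c : ℕ) : ℤ) ^ (j + 1) ≤ 2 ^ ((e + 1) * n) := by
    have hac : a + c ≤ 2 ^ (e + 1) := by rw [pow_succ]; omega
    have hjn : j + 1 ≤ n := by omega
    rw [pow_mul]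
    exact_mod_cast (Nat.pow_le_pow_left hac _).trans (Nat.pow_le_pow_right (by positivity) hjn)
  have hlt {z : ℤ} (hz : |z| ≤ 2 * 2 ^ ((e + 1) * n)) : z.natAbs < 2 ^ ((e + 1) * n + 2) := by
    have hpos : (0 : ℤ) < 2 ^ ((e + 1) * n) := by positivity
    zify
    rw [pow_add]
    linarith
  refine ⟨(bitLength_natCast_div_natCast_le hc ha hc').trans he, fun j i hi hji hf => ?_,
    fun j i hi hji hf => ?_⟩ <;>
  obtain ⟨N, D, hD, hN, hD', heq⟩ := hl.exists_int_one_sub_weightAt hc hi hji hf <;>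
  have := hpow hi hji
  · have hval : weightAt G L ((a : ℚ) / c) j L[i] = ((D - N : ℤ) : ℚ) / D := by
      rw [← sub_sub_cancel 1 (weightAt _ _ _ _ _), heq, Int.cast_sub, sub_div,
        div_self (Int.cast_ne_zero.2 hD)]
    rw [hval]
    refine (bitLength_div_le hD (hlt ?_) (hlt ?_)).trans hb <;>
      linarith [abs_sub D N, abs_nonneg D]
  · rw [heq]
    refine (bitLength_div_le hD (hlt ?_) (hlt ?_)).trans hb <;>
      linarith [abs_nonneg D, abs_nonneg N]

/-- The bit length that suffices for inputs with `n` vertices and accuracy `1`. -/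
noncomputable def bitBound : Polynomial ℕ := 2 * (Polynomial.X + 3) * (Polynomial.X + 1)

theorem bitBound_eval (n : ℕ) : bitBound.eval n = 2 * (n + 3) * (n + 1) := by
  simp [bitBound]

theorem indicesFit_bitBound (hk : 1 ≤ k) : IndicesFit n (k * bitBound.eval n) := by
  intro m hm
  refine (bitLength_natCast_le hm).trans ?_
  rw [bitBound_eval]
  nlinarith

theorem two_mul_exponent_le_bitBound (hk : 1 ≤ k) :
    2 * (n + k + 1) ≤ k * bitBound.eval n ∧ 2 * ((n + k + 2) * n + 2) ≤ k * bitBound.eval n := by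
  have h : n + k + 2 ≤ k * (n + 3) := by nlinarith
  rw [bitBound_eval]
  constructor <;> nlinarith

theorem lt_two_pow_of_le_mul_two_pow (hj : j ≤ k) (hc : c ≤ (n + 1) * 2 ^ j) :
    c < 2 ^ (n + k + 1) := by
  calc c ≤ (n + 1) * 2 ^ j := hc
    _ ≤ 2 ^ n * 2 ^ k := Nat.mul_le_mul Nat.lt_two_pow_self (Nat.pow_le_pow_right two_pos hj)
    _ = 2 ^ (n + k) := (pow_add 2 n k).symm
    _ < 2 ^ (n + k + 1) := Nat.pow_lt_pow_succ one_lt_two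

theorem bitLength_dyadic_le (hk : 1 ≤ k) (hj : j ≤ k) (hc : c ≤ (n + 1) * 2 ^ j) :
    bitLength ((c : ℚ) / 2 ^ j) ≤ k * bitBound.eval n := by
  have h := bitLength_natCast_div_natCast_le (pow_ne_zero j two_ne_zero)
    (lt_two_pow_of_le_mul_two_pow hj hc)
    (Nat.pow_lt_pow_right one_lt_two (by omega : j < n + k + 1))
  rw [Nat.cast_pow, Nat.cast_ofNat] at h
  exact h.trans (two_mul_exponent_le_bitBound hk).1

theorem IsElimOrder.weightsFit_inv_dyadic (hl : IsElimOrder G L) (hL : L.length = n) (hk : 1 ≤ k)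
    (hj : j ≤ k) (hc0 : c ≠ 0) (hc : c ≤ (n + 1) * 2 ^ j) :
    WeightsFit G L ((c : ℚ) / 2 ^ j)⁻¹ (k * bitBound.eval n) := by
  obtain ⟨h₁, h₂⟩ := two_mul_exponent_le_bitBound (n := n) hk
  rw [inv_div]
  exact_mod_cast hl.weightsFit hL hc0
    (Nat.pow_lt_pow_right one_lt_two (by omega : j < n + k + 1))
    (lt_two_pow_of_le_mul_two_pow hj hc) h₁ h₂

end Size

section DyadicFloor

/-- The largest multiple of `1 / 2 ^ j` that is at most `x`, for a nonnegative real number `x`. -/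
noncomputable def dyadicFloor (x : ℝ) (j : ℕ) : ℚ := ⌊x * 2 ^ j⌋₊ / 2 ^ j

theorem dyadicFloor_zero (x : ℝ) : dyadicFloor x 0 = ⌊x⌋₊ := by simp [dyadicFloor]

theorem dyadicFloor_natCast (m j : ℕ) : dyadicFloor m j = m := by
  rw [dyadicFloor, show (m : ℝ) * 2 ^ j = ((m * 2 ^ j : ℕ) : ℝ) by push_cast; rfl,
    Nat.floor_natCast]
  simp

theorem abs_dyadicFloor_sub_le {x : ℝ} (hx : 0 ≤ x) (j : ℕ) :
    |(dyadicFloor x j : ℝ) - x| ≤ 1 / 2 ^ j := by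
  have hle : (⌊x * 2 ^ j⌋₊ : ℝ) ≤ x * 2 ^ j := Nat.floor_le (by positivity)
  have hlt : x * 2 ^ j < ⌊x * 2 ^ j⌋₊ + 1 := Nat.lt_floor_add_one _
  have hsub : (dyadicFloor x j : ℝ) - x = (⌊x * 2 ^ j⌋₊ - x * 2 ^ j) / 2 ^ j := by
    simp only [dyadicFloor]
    push_cast
    field_simp
  rw [hsub, abs_div, abs_of_pos (by positivity : (0 : ℝ) < 2 ^ j)]
  gcongr
  rw [abs_le]
  constructor <;> linarith

theorem dyadicFloor_add_eq (x : ℝ) (j : ℕ) : dyadicFloor x j + 1 / 2 ^ (j + 1) =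
    ((2 * ⌊x * 2 ^ j⌋₊ + 1 : ℕ) : ℚ) / 2 ^ (j + 1) := by
  rw [dyadicFloor]
  push_cast
  field_simp
  ring

theorem dyadicFloor_succ {x : ℝ} (hx : 0 ≤ x) (j : ℕ) : dyadicFloor x (j + 1) =
    if ((dyadicFloor x j + 1 / 2 ^ (j + 1) : ℚ) : ℝ) ≤ x then dyadicFloor x j + 1 / 2 ^ (j + 1)
    else dyadicFloor x j := by
  have hhalf : ⌊x * 2 ^ (j + 1)⌋₊ / 2 = ⌊x * 2 ^ j⌋₊ := by
    rw [← Nat.floor_div_ofNat, pow_succ, ← mul_assoc]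
    simp
  have hiff : ((dyadicFloor x j + 1 / 2 ^ (j + 1) : ℚ) : ℝ) ≤ x ↔
      2 * ⌊x * 2 ^ j⌋₊ + 1 ≤ ⌊x * 2 ^ (j + 1)⌋₊ := by
    rw [dyadicFloor_add_eq, Nat.le_floor_iff (by positivity)]
    push_cast
    rw [div_le_iff₀ (by positivity)]
  split_ifs with h <;> rw [hiff] at h
  · rw [dyadicFloor_add_eq, dyadicFloor]
    congr 2
    omega
  · have hdouble : ⌊x * 2 ^ (j + 1)⌋₊ = 2 * ⌊x * 2 ^ j⌋₊ := by omega
    rw [dyadicFloor, dyadicFloor, hdouble]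
    push_cast
    field_simp
    ring

end DyadicFloor

/-! ### The search -/

section Search

/-- Add the step in register `14` to the number in register `13` if the result does not exceed the
fractional hat chromatic number. -/
def Prog.advance : Prog :=
  .seq (.arith .add 15 13 14) (.guard .infeasible (.arith .add 13 15 3))

/-- Write the constants and compute an elimination order. -/
def Prog.setup : Prog :=
  .seq (.const 2 1) (.seq (.const 14 1) (.seq (.const 21 2) .findOrder))

/-- Compute the integer part of the fractional hat chromatic number. -/
def Prog.integerPart : Prog :=
  .forAll 20 .advance

/-- Compute one more binary digit of the fractional hat chromatic number. -/
def Prog.bisect : Prog :=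
  .seq (.arith .div 14 14 21) .advance

/-- The algorithm. -/
def Prog.main : Prog :=
  .seq .setup (.seq .integerPart (.seq (.count 22 1 .bisect) (.arith .add 0 13 3)))

variable {n k : ℕ} {G : SimpleGraph (Fin n)} {L : List (Fin n)} {s : State} {z d : ℚ}

theorem IsElimOrder.mem_of_length_eq (hl : IsElimOrder G L) (hL : L.length = n) (v : Fin n) :
    v ∈ L := by
  have hcard : L.toFinset.card = Fintype.card (Fin n) := by
    rw [List.toFinset_card_of_nodup hl.nodup, hL, Fintype.card_fin]
  rw [← List.mem_toFinset, (Finset.card_eq_iff_eq_univ _).1 hcard]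
  exact Finset.mem_univ v

/-- The search is in a state in which `z` is the current lower bound for the fractional hat
chromatic number and `d` is the current step. -/
structure HoldsSearch (G : SimpleGraph (Fin n)) (L : List (Fin n)) (z d : ℚ) (s : State) : Prop
    extends HoldsOrder G L s where
  two : s.reg 21 = 2
  current : s.reg 13 = z
  step : s.reg 14 = d

theorem HoldsSearch.frame {P : Prog} {s' : State} (h : HoldsSearch G L z d s) (hf : Frame P s s')
    (hP : ((P.writesReg 0 = false ∧ P.writesReg 2 = false ∧ P.writesReg 3 = false ∧
      P.writesArr 0 = false) ∧ P.writesArr 2 = false) ∧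
      P.writesReg 21 = false ∧ P.writesReg 13 = false ∧ P.writesReg 14 = false) :
    HoldsSearch G L z d s' :=
  ⟨h.toHoldsOrder.frame hf hP.1, (hf.reg hP.2.1).trans h.two, (hf.reg hP.2.2.1).trans h.current,
    (hf.reg hP.2.2.2).trans h.step⟩

theorem holdsElim_input (G : SimpleGraph (Fin n)) (k : ℕ) :
    HoldsElim G [] ((input G k).setReg 2 1) := by
  classical
  refine ⟨⟨by simp [input], by simp, by simp [input], fun u v => ?_⟩, fun v => by simp [input]⟩
  simp only [State.arr_setReg, input, true_and]
  refine if_congr ⟨?_, fun h => ⟨u, v, h, rfl⟩⟩ rfl rfl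
  rintro ⟨u', v', h, heq⟩
  have hu : (u : ℕ) = u' := by
    simpa [Nat.mul_add_div u.pos, Nat.div_eq_of_lt] using congrArg (· / n) heq
  have hv : (v : ℕ) = v' := by
    rw [hu] at heq
    omega
  rwa [Fin.ext hu, Fin.ext hv]

variable [NeZero n]

theorem does_advance (hs : HoldsSearch G L z d s) (hl : IsElimOrder G L) (hL : L.length = n)
    (hk : 1 ≤ k) {c j : ℕ} (hj : j ≤ k) (hc0 : c ≠ 0) (hc : c ≤ (n + 1) * 2 ^ j)
    (hzd : z + d = c / 2 ^ j) :
    Does (k * bitBound.eval n) n .advance s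
      (HoldsSearch G L (if ((z + d : ℚ) : ℝ) ≤ fracHatNumber G then z + d else z) d) := by
  have hb := indicesFit_bitBound (n := n) hk
  have hbit : bitLength (z + d) ≤ k * bitBound.eval n := hzd ▸ bitLength_dyadic_le hk hj hc
  have hfit : WeightsFit G L (z + d)⁻¹ (k * bitBound.eval n) :=
    hzd ▸ hl.weightsFit_inv_dyadic hL hk hj hc0 hc
  have hpos : 0 < z + d := by rw [hzd]; positivity
  have hiff := hl.le_fracHatNumber_iff (hl.mem_of_length_eq hL) hpos
  refine .seq (.arith (z + d) (by simp [Op.eval, hs.current, hs.step]) hbit ?_)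
  replace hs := hs.frame (.setReg s 15 (z + d)) (by decide)
  have h15 : (s.setReg 15 (z + d)).reg 15 = z + d := by simp
  have htest := decides_infeasible hs.toHoldsOrder hb hfit hL h15
  rw [← hiff] at htest
  refine .guard hs.zero (by decide) htest (fun hp s₁ f₁ => ?_) (fun hp s₁ f₁ => ?_)
  · replace hs := hs.frame f₁ (by decide)
    rw [← f₁.reg (r := 15) rfl] at h15
    rw [if_pos hp]
    exact .arith (z + d) (by simp [Op.eval, h15, hs.zero]) hbit
      ⟨hs.toHoldsOrder.frame (.setReg s₁ 13 (z + d)) (by decide), by simpa using hs.two, by simp,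
        by simpa using hs.step⟩
  · rw [if_neg hp]
    exact hs.frame f₁ (by decide)

theorem floor_fracHatNumber_mul_two_pow_le (G : SimpleGraph (Fin n)) (j : ℕ) :
    ⌊fracHatNumber G * 2 ^ j⌋₊ ≤ n * 2 ^ j := by
  refine Nat.floor_le_of_le ?_
  push_cast
  gcongr
  simpa using fracHatNumber_le_card G

theorem does_integerPart (hs : HoldsSearch G L 0 1 s) (hl : IsElimOrder G L) (hL : L.length = n)
    (hk : 1 ≤ k) : Does (k * bitBound.eval n) n .integerPart s
      (HoldsSearch G L (dyadicFloor (fracHatNumber G) 0) 1) := by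
  have hb := indicesFit_bitBound (n := n) hk
  have hμ : 0 ≤ fracHatNumber G := zero_le_one.trans (one_le_fracHatNumber G)
  have hfloor : ⌊fracHatNumber G⌋₊ ≤ n := by
    simpa using floor_fracHatNumber_mul_two_pow_le G 0
  refine (Does.forAll (fun i => HoldsSearch G L ((min i ⌊fracHatNumber G⌋₊ : ℕ) : ℚ) 1) (by decide)
    hb.le hs.size hs.one (fun j s q h => h.frame (.setReg s 20 q) (by decide)) (by simpa using hs)
    fun i hi s₁ hs₁ _ _ => ?_).mono fun s' h' _ => ?_
  · have hsum : ((min i ⌊fracHatNumber G⌋₊ : ℕ) : ℚ) + 1 =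
        ((min i ⌊fracHatNumber G⌋₊ + 1 : ℕ) : ℚ) / 2 ^ 0 := by simp
    refine (does_advance hs₁ hl hL hk k.zero_le (Nat.succ_ne_zero _) (by omega) hsum).mono
      fun s' h' _ => ?_
    have hiff : (((min i ⌊fracHatNumber G⌋₊ : ℕ) + 1 : ℚ) : ℝ) ≤ fracHatNumber G ↔
        min i ⌊fracHatNumber G⌋₊ + 1 ≤ ⌊fracHatNumber G⌋₊ := by
      rw [Nat.le_floor_iff hμ]
      push_cast
      rfl
    convert h' using 1
    split_ifs with h <;> rw [hiff] at h
    · rw [← Nat.cast_succ, Nat.cast_inj]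
      omega
    · rw [Nat.cast_inj]
      omega
  · rwa [min_eq_right hfloor, ← dyadicFloor_zero] at h'

theorem does_bisect {j : ℕ}
    (hs : HoldsSearch G L (dyadicFloor (fracHatNumber G) j) (1 / 2 ^ j) s) (hl : IsElimOrder G L)
    (hL : L.length = n) (hk : 1 ≤ k) (hj : j < k) : Does (k * bitBound.eval n) n .bisect s
      (HoldsSearch G L (dyadicFloor (fracHatNumber G) (j + 1)) (1 / 2 ^ (j + 1))) := by
  have hμ : 0 ≤ fracHatNumber G := zero_le_one.trans (one_le_fracHatNumber G)
  have hhalf : Op.div.eval (s.reg 14) (s.reg 21) = 1 / 2 ^ (j + 1) := by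
    rw [hs.step, hs.two, Op.eval, div_div, pow_succ]
  have hbit : bitLength (1 / 2 ^ (j + 1)) ≤ k * bitBound.eval n := by
    simpa using bitLength_dyadic_le (c := 1) hk hj (Nat.mul_pos n.succ_pos (Nat.two_pow_pos _))
  have hfloor := floor_fracHatNumber_mul_two_pow_le G j
  refine .seq (.arith _ hhalf hbit ?_)
  rw [dyadicFloor_succ hμ]
  refine does_advance ⟨hs.toHoldsOrder.frame (.setReg s 14 _) (by decide), by simpa using hs.two,
    by simpa using hs.current, by simp⟩ hl hL hk hj (Nat.succ_ne_zero _) ?_ (dyadicFloor_add_eq _ j)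
  rw [pow_succ]
  nlinarith [Nat.two_pow_pos j]

theorem does_setup (hG : IsChordal G) (hk : 1 ≤ k) :
    Does (k * bitBound.eval n) n .setup (input G k) fun s => s.reg 1 = k ∧ s.reg 22 = 0 ∧
      ∃ L, L.length = n ∧ IsElimOrder G L ∧ HoldsSearch G L 0 1 s := by
  have hb := indicesFit_bitBound (n := n) hk
  have htwo : bitLength 2 ≤ k * bitBound.eval n := by
    simpa using hb 2 (by nlinarith [NeZero.one_le (n := n)])
  have hs := ((holdsElim_input G k).frame (.setReg _ 14 1) (by decide)).frame (.setReg _ 21 2)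
    (by decide)
  refine .seq (.const hb.one (.seq (.const hb.one (.seq (.const htwo ?_)))))
  refine (does_findOrder hG hs hb).mono fun s ⟨L, hL, hl, hlist⟩ f => ?_
  refine ⟨(f.reg rfl).trans (by simp [input]), (f.reg rfl).trans (by simp [input]), L, hL, hl,
    ⟨(hs.toHoldsGraph.frame f (by decide)), hlist⟩, ?_, ?_, ?_⟩ <;>
  exact (f.reg rfl).trans (by simp [input])

theorem halts_main (hG : IsChordal G) (hk : 1 ≤ k) :
    Halts (k * bitBound.eval n)
      (2 * k * (Prog.setup.cost + Prog.integerPart.cost + Prog.bisect.cost + 4).eval n)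
      .main (input G k) fun s => s.output = dyadicFloor (fracHatNumber G) k := by
  have hbit (j : ℕ) (hj : j ≤ k) : bitLength (j : ℚ) ≤ k * bitBound.eval n := by
    refine (bitLength_natCast_le hj).trans ?_
    have hpos : 2 ≤ bitBound.eval n := by rw [bitBound_eval]; nlinarith
    nlinarith
  have hout : bitLength (dyadicFloor (fracHatNumber G) k) ≤ k * bitBound.eval n :=
    bitLength_dyadic_le hk le_rfl ((floor_fracHatNumber_mul_two_pow_le G k).trans
      (Nat.mul_le_mul_right _ n.le_succ))
  have hrun : Halts (k * bitBound.eval n)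
      (Prog.setup.cost.eval n + (Prog.integerPart.cost.eval n +
        ((k * (Prog.bisect.cost.eval n + 2) + 1) + (Prog.arith .add 0 13 3).cost.eval n)))
      .main (input G k) fun s => s.output = dyadicFloor (fracHatNumber G) k := by
    refine .seq ((does_setup hG hk).mono fun s₁ ⟨h1, h22, L, hL, hl, hs₁⟩ _ => ?_)
    refine .seq ((does_integerPart hs₁ hl hL hk).mono fun s₂ hs₂ f₂ => ?_)
    refine .seq ((Halts.count (N := k) (T := Prog.bisect.cost.eval n)
      (fun j => HoldsSearch G L (dyadicFloor (fracHatNumber G) j) (1 / 2 ^ j))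
      rfl rfl rfl (by decide) (by decide) hbit ((f₂.reg rfl).trans h1) hs₂.one
      ((f₂.reg rfl).trans h22) (fun j s q h => h.frame (.setReg s 22 q) (by decide))
      (by simpa using hs₂) fun j hj s₃ hs₃ _ _ => does_bisect hs₃ hl hL hk hj).mono le_rfl
      fun s₃ hs₃ _ => ?_)
    exact Does.arith _ (by simp [Op.eval, hs₃.current, hs₃.zero]) hout (by simp [State.output])
  refine hrun.mono ?_ fun s h _ => h
  simp only [Prog.cost, Polynomial.eval_add, Polynomial.eval_ofNat, Polynomial.eval_one]
  nlinarith

end Search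

end HatGuessing

theorem theorem6 :
    ∃ (A : HatGuessing.Prog) (p q : Polynomial ℕ),
      ∀ (n : ℕ), 1 ≤ n → ∀ (G : SimpleGraph (Fin n)), HatGuessing.IsChordal G →
        ∀ (k : ℕ), 1 ≤ k →
          ∃ (t : ℕ) (s : HatGuessing.State),
            HatGuessing.Run (k * q.eval n) A (HatGuessing.input G k) t s ∧
            t ≤ 2 * k * p.eval n ∧
            |(s.output : ℝ) - HatGuessing.fracHatNumber G| ≤ 1 / 2 ^ k ∧
            ((∃ r : ℚ, HatGuessing.fracHatNumber G = (r : ℝ)) →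
              (s.output : ℝ) = HatGuessing.fracHatNumber G ∧
              ∃ m : ℕ, HatGuessing.fracHatNumber G = (m : ℝ)) := by
  refine ⟨HatGuessing.Prog.main, HatGuessing.Prog.setup.cost +
    HatGuessing.Prog.integerPart.cost + HatGuessing.Prog.bisect.cost + 4,
    HatGuessing.bitBound, fun n hn G hG k hk => ?_⟩
  have : NeZero n := ⟨by omega⟩
  obtain ⟨t, s, hrun, ht, hout⟩ := HatGuessing.halts_main hG hk
  refine ⟨t, s, hrun, ht, ?_, fun hr => ?_⟩
  · rw [hout]
    exact HatGuessing.abs_dyadicFloor_sub_le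
      (zero_le_one.trans (HatGuessing.one_le_fracHatNumber G)) k
  · obtain ⟨m, hm⟩ := hG.exists_nat_eq_fracHatNumber hr
    refine ⟨?_, m, hm⟩
    rw [hout, hm, HatGuessing.dyadicFloor_natCast, Rat.cast_natCast]
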